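/- **Definitions.** A permutation $\pi$ of $\{1,\dots,n\}$ is \emph{Baxter} if there are no $i<j<k$ with $\pi(j+1)<\pi(i)<\pi(k)<\pi(j)$ or $\pi(j)<\pi(k)<\pi(i)<\pi(j+1)$. Its diagram is the set of points $(i,\pi(i))$. Let $\mathrm{rev}(\pi)=\pi(n)\cdots\pi(1)$ and let $\rho(\pi)$ be the permutation whose diagram is obtained from that of $\pi$ by the clockwise rotation by $90^\circ$, i.e. by $\rho:(x,y)\mapsto(y,n+1-x)$. A \emph{plane bipolar orientation} is an acyclic orientation of a connected planar map (a connected graph embedded in the plane without edge crossings, up to orientation-preserving deformation, with a distinguished outer face) having a unique source $s$ and a unique sink $t$, both on the outer face. Its mirror image $\mathrm{mir}(O)$ is obtained by flipping $O$ around a line. Its dual $O^*$ has one vertex in each inner face of $O$, and two vertices in the outer face: the source of $O^*$, to the right of the right border of $O$ (the path from $s$ to $t$ with the outer face on its right), and the sink of $O^*$, to the left of the left border. Each edge $e$ of $O$ has a dual edge $e^*$, which crosses $e$ from the face on the right of $e$ to the face on the left of $e$. The outer face of $O^*$ contains $s$ and $t$. For a Baxter permutation $\pi$ of size $n\ge 1$,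 put $\pi(0)=0$ and $\pi(n+1)=n+1$. For each $a\in\{0,\dots,n\}$ with $\pi(a)<\pi(a+1)$ let $\ell_a=\max\{\pi(i): 0\le i<a+1,\ \pi(i)<\pi(a+1)\}$, and create a white vertex $w_a=(a+\frac12,\ell_a+\frac12)$. The black vertices are the points $b_i=(i,\pi(i))$, $1\le i\le n$. Let $\phi(\pi)$ be the Hasse diagram of the set of black and white vertices for the product order on $\mathbb R^2$, drawn with straight edges directed to the North-East. Each black vertex has indegree and outdegree $1$ in $\phi(\pi)$ and two white neighbours. Erasing the black vertices gives $\Phi(\pi)$; the edge of $\Phi(\pi)$ that passes through $b_i$ is said to \emph{correspond} to the point $(i,\pi(i))$. **Proposition.** Let $n\ge1$ and let $\pi$ be a Baxter permutation of $\{1,\dots,n\}$. Then $\pi^{-1}$, $\mathrm{rev}(\pi)$ and $\rho(\pi)$ are Baxter permutations, each black vertex of $\phi(\pi)$ has indegree and outdegree $1$ and white neighbours, and $O=\Phi(\pi)$ is a plane bipolar orientation with source $w_0$ and sink $w_n$. Moreover, $$\Phi(\pi^{-1})=\mathrm{mir}(O),\qquad \Phi(\mathrm{rev}(\pi))=\mathrm{mir}(O^*),\qquad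 \Phi(\rho(\pi))=O^*,$$ and, if the point $p=(i,\pi(i))$ of $\pi$ corresponds to the edge $e$ of $O$, then in these identifications the point $(\pi(i),i)$ of $\pi^{-1}$ corresponds to the edge $\mathrm{mir}(e)$ of $\mathrm{mir}(O)$, the point $(n+1-i,\pi(i))$ of $\mathrm{rev}(\pi)$ corresponds to the edge $\mathrm{mir}(e^*)$ of $\mathrm{mir}(O^*)$, and the point $\rho(p)=(\pi(i),n+1-i)$ of $\rho(\pi)$ corresponds to the dual edge $e^*$ of $O^*$. -/

import Mathlib

/-!  Plane bipolar orientations as rotation systems, Baxter permutations, and the map `Phi`.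

A connected graph embedded in the oriented plane with no edge-crossings is, up to continuous
deformation, the same thing as the clockwise cyclic order of the half-edges around every vertex
(a rotation system of genus `0`) together with the choice of an outer face. -/

namespace BaxterBipolar

/-- The two half-edges of an oriented edge `e`: `(e, false)` is its tail half (attached to its
starting point), `(e, true)` its head half (attached to its endpoint). -/
abbrev Dart (E : Type*) := E × Bool

/-- Exchanges the two halves of every edge. -/
def flip (E : Type*) : Equiv.Perm (Dart E) := (Equiv.refl E).prodCongr Equiv.boolNot

/-- An oriented map with edge set `E` and two marked corners.

`rot d` is the half-edge that follows `d` in clockwise order around the vertex of `d`, so vertices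
are the cycles of `rot`.  A half-edge `d` also stands for the corner between `rot⁻¹ d` and `d`:
the one on the left of a traveller who leaves the vertex along `d`.
`src` is the corner of the outer face at the source, and `snk` the corner of the outer face at the
sink (so the outer face is the face which contains these two corners). In a plane bipolar
orientation, the outer face has exactly one corner at each of the two poles, so that marking the
corners is the same as choosing the outer face. -/
structure BipolarMap (E : Type*) where
  rot : Equiv.Perm (Dart E)
  src : Dart E
  snk : Dart E

namespace BipolarMap

variable {E F : Type*}

/-- The vertices: the cycles of `rot`. -/
def Vertex (M : BipolarMap E) : Type _ := Quotient (Equiv.Perm.SameCycle.setoid M.rot)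

/-- The vertex to which a half-edge is attached. -/
def vertex (M : BipolarMap E) (d : Dart E) : M.Vertex := Quotient.mk _ d

/-- Walking along `d`, away from its vertex, and then along the border of the face on the left of
`d`, the next half-edge by which one leaves a vertex. The walk goes counterclockwise around the
face. -/
def faceNext (M : BipolarMap E) : Equiv.Perm (Dart E) := M.rot * flip E

/-- The faces (including the outer one): the cycles of `faceNext`. -/
def Face (M : BipolarMap E) : Type _ := Quotient (Equiv.Perm.SameCycle.setoid M.faceNext)

/-- The face on the left of a half-edge, seen from its vertex. Thus the face on the left of the
oriented edge `e` is `leftFace (e, false)`, and the face on its right is `leftFace (e, true)`. -/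
def leftFace (M : BipolarMap E) (d : Dart E) : M.Face := Quotient.mk _ d

/-- `v` has no ingoing edge. -/
def IsSource (M : BipolarMap E) (v : M.Vertex) : Prop := ∀ e : E, M.vertex (e, true) ≠ v

/-- `v` has no outgoing edge. -/
def IsSink (M : BipolarMap E) (v : M.Vertex) : Prop := ∀ e : E, M.vertex (e, false) ≠ v

/-- `M` is a plane bipolar orientation (with at least one edge). -/
structure IsPlaneBipolar (M : BipolarMap E) : Prop where
  finite : Finite E
  connected : ∀ d d' : Dart E, ∃ g ∈ Subgroup.closure {M.rot, flip E}, g d = d'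
  /-- Euler's formula: the map is drawn on the sphere. -/
  euler : Nat.card M.Vertex + Nat.card M.Face = Nat.card E + 2
  /-- There is no oriented cycle. -/
  acyclic : ∀ e : E,
    ¬ Relation.TransGen (fun e₁ e₂ : E => M.vertex (e₁, true) = M.vertex (e₂, false)) e e
  unique_source : ∀ v : M.Vertex, M.IsSource v ↔ v = M.vertex M.src
  unique_sink : ∀ v : M.Vertex, M.IsSink v ↔ v = M.vertex M.snk
  /-- Both poles lie on the outer face. -/
  outer : M.leftFace M.src = M.leftFace M.snk

/-- The bijection `f` between the edges is an isomorphism of oriented plane maps: `M` and `N`, with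
edges relabelled according to `f`, are equal up to orientation-preserving deformation. -/
structure IsIso (f : E ≃ F) (M : BipolarMap E) (N : BipolarMap F) : Prop where
  map_rot : ∀ d : Dart E, N.rot (Prod.map f id d) = Prod.map f id (M.rot d)
  map_src : N.src = Prod.map f id M.src
  map_snk : N.snk = Prod.map f id M.snk

/-- The mirror image: all cyclic orders are reversed, the orientation of the edges is kept.
The mirror image of the edge `e` is labelled `e`. The corner between `rot⁻¹ d` and `d` becomes the
corner between `d` and `rot⁻¹ d`. -/
def mir (M : BipolarMap E) : BipolarMap E where
  rot := M.rot⁻¹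
  src := M.rot⁻¹ M.src
  snk := M.rot⁻¹ M.snk

/-- The walk around the faces, after the outer face has been cut into two along a curve that runs
through it from the corner `src` to the corner `snk`. The right border, walked from the sink down
to the source, now closes up at the sink; and the left border, walked from the source up to the
sink, closes up at the source. Hence the cycles of `cutFaceNext` are the vertices of the dual: one
for each inner face, and two for the outer face. -/
def cutFaceNext [DecidableEq E] (M : BipolarMap E) : Equiv.Perm (Dart E) :=
  Equiv.swap M.src M.snk * M.faceNext

/-- The dual plane orientation. The dual edge of `e` is labelled `e`; it goes from the face on the
right of `e` to the face on the left of `e`. Hence its tail half `(e, false)` lies in the face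
`M.leftFace (e, true)`, its head half in the face `M.leftFace (e, false)`, and the clockwise order
around the vertices of the dual is the inverse of `cutFaceNext`, after exchanging `false` and
`true`. The outer face of `O` contains the two poles of the dual: the source to the right of the
right border, the sink to the left of the left border. The outer face of the dual contains the
poles of `O`: its corner at the source comes just before the edge dual to the first edge
of the right border, and its corner at the sink just before the edge dual to the last edge of
the left border. -/
def dual [DecidableEq E] (M : BipolarMap E) : BipolarMap E where
  rot := flip E * M.cutFaceNext⁻¹ * flip E
  src := M.rot⁻¹ M.src
  snk := M.rot⁻¹ M.snk

end BipolarMap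

/-- `π` is a Baxter permutation. -/
def IsBaxter {n : ℕ} (π : Equiv.Perm (Fin n)) : Prop :=
  ¬ ∃ i j j' k : Fin n, i < j ∧ j < k ∧ (j' : ℕ) = j + 1 ∧
    ((π j' < π i ∧ π i < π k ∧ π k < π j) ∨ (π j < π k ∧ π k < π i ∧ π i < π j'))

/-- The reversion `π(n) ... π(1)` of `π(1) ... π(n)`. -/
def rev {n : ℕ} (π : Equiv.Perm (Fin n)) : Equiv.Perm (Fin n) := π * Fin.revPerm

/-- The clockwise rotation by 90 degrees, which moves the point `(i, π(i))` of the diagram to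
the point `(π(i), n + 1 - i)`. -/
def rho {n : ℕ} (π : Equiv.Perm (Fin n)) : Equiv.Perm (Fin n) := Fin.revPerm * π⁻¹

section Drawing

variable {n : ℕ} (π : Equiv.Perm (Fin n))

/-- The values `π(1), ..., π(n)` with the usual numbering from `1` to `n`, and the convention
`π(0) = 0` and `π(n+1) = n+1`. -/
def value (k : ℕ) : ℕ :=
  if k = 0 then 0 else if h : k - 1 < n then π ⟨k - 1, h⟩ + 1 else n + 1

/-- `a` is `0`, or an ascent of `π`, or `n`. -/
def IsAscent (a : ℕ) : Prop := a ≤ n ∧ value π a < value π (a + 1)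

/-- `ℓ_a = max {π(i) : i < a + 1 and π(i) < π(a+1)}`. -/
def level (a : ℕ) : ℕ :=
  ((Finset.range (a + 1)).filter (fun i => value π i < value π (a + 1))).sup (value π)

/-- The points of the diagram of `π`. -/
noncomputable def black (i : Fin n) : ℝ × ℝ := ((i : ℝ) + 1, ((π i : ℕ) : ℝ) + 1)

/-- The white point `w_a`. -/
noncomputable def white (a : ℕ) : ℝ × ℝ := ((a : ℝ) + 1 / 2, (level π a : ℝ) + 1 / 2)

/-- All black and white vertices, with the product order of the plane. The digraph `φ(π)` is the
Hasse diagram of this ordered set, with an edge from `v` to `w` if `v ⋖ w`. -/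
abbrev Points : Type :=
  ((Set.range (black π) ∪ {p | ∃ a, IsAscent π a ∧ p = white π a} : Set (ℝ × ℝ)))

/-- A point of the diagram, as a vertex of `φ(π)`. -/
noncomputable def blackVertex (i : Fin n) : Points π := ⟨black π i, Or.inl ⟨i, rfl⟩⟩

/-- Every black vertex has indegree and outdegree `1` in `φ(π)`, and its two neighbours are
white. -/
def BlackDegreesOne : Prop :=
  ∀ i : Fin n,
    (∃ a, IsAscent π a ∧ ∀ v : Points π, v ⋖ blackVertex π i ↔ (v : ℝ × ℝ) = white π a) ∧
    (∃ a, IsAscent π a ∧ ∀ v : Points π, blackVertex π i ⋖ v ↔ (v : ℝ × ℝ) = white π a)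

open Classical in
/-- Erasing the black vertices turns the black vertex `b_i` into an edge `i`, which goes from the
vertex covered by `b_i` to the vertex that covers `b_i`. This is the vertex of `φ(π)` to which a
half-edge is attached. -/
noncomputable def endpoint : Dart (Fin n) → ℝ × ℝ
  | (i, false) =>
    (@Classical.epsilon (Points π) ⟨blackVertex π i⟩ fun v => v ⋖ blackVertex π i : Points π)
  | (i, true) =>
    (@Classical.epsilon (Points π) ⟨blackVertex π i⟩ fun v => blackVertex π i ⋖ v : Points π)

/-- The argument, in `(-π, π]`, of the vector from the vertex of a half-edge of `i` to `b_i`. -/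
noncomputable def angle (d : Dart (Fin n)) : ℝ :=
  Complex.arg ⟨(black π d.1).1 - (endpoint π d).1, (black π d.1).2 - (endpoint π d).2⟩

open Classical in
/-- The half-edges attached to `v`, in clockwise order, starting from the West: this is the order
of decreasing arguments. -/
noncomputable def dartsAt (v : ℝ × ℝ) : List (Dart (Fin n)) :=
  (Finset.univ.filter (fun d => endpoint π d = v)).toList.insertionSort
    (fun d d' => angle π d' ≤ angle π d)

theorem mem_dartsAt (v : ℝ × ℝ) (d : Dart (Fin n)) : d ∈ dartsAt π v ↔ endpoint π d = v := by
  simp [dartsAt]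

theorem endpoint_eq_of_mem_iff {d d' : Dart (Fin n)}
    (h : d' ∈ dartsAt π (endpoint π d) ↔ d ∈ dartsAt π (endpoint π d)) :
    endpoint π d' = endpoint π d := by
  simpa [mem_dartsAt] using h

theorem endpoint_formPerm (d : Dart (Fin n)) :
    endpoint π ((dartsAt π (endpoint π d)).formPerm d) = endpoint π d :=
  endpoint_eq_of_mem_iff π List.formPerm_mem_iff_mem

theorem endpoint_formPerm_inv (d : Dart (Fin n)) :
    endpoint π ((dartsAt π (endpoint π d)).formPerm⁻¹ d) = endpoint π d := by
  refine endpoint_eq_of_mem_iff π ?_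
  rw [← List.formPerm_mem_iff_mem (l := dartsAt π (endpoint π d))]
  simp

/-- The half-edge that follows a half-edge in clockwise order around its vertex. -/
noncomputable def rotation : Equiv.Perm (Dart (Fin n)) where
  toFun d := (dartsAt π (endpoint π d)).formPerm d
  invFun d := (dartsAt π (endpoint π d)).formPerm⁻¹ d
  left_inv d := by simp only [endpoint_formPerm]; simp
  right_inv d := by simp only [endpoint_formPerm_inv]; simp

/-- The map `Φ(π)`, obtained from the drawing of `φ(π)` with straight edges by erasing the black
vertices. Its edges are labelled by the abscissas: the edge that corresponds to the point
`(i, π(i))` of the diagram is labelled `i`.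

As `φ(π)` lies to the North-East of `w_0` and to the South-West of `w_n`, the corners that
belong to the unbounded face are the one which is open to the West (and South) at `w_0`, and the
one which is open to the North (and East) at `w_n`. Since the half-edges at `w_0` point
North-East and those at `w_n` point South-West, it is in both cases the corner just before the
half-edge of largest argument. -/
noncomputable def Phi [NeZero n] : BipolarMap (Fin n) where
  rot := rotation π
  src := (dartsAt π (white π 0)).headD (0, false)
  snk := (dartsAt π (white π n)).headD (0, true)

end Drawing

end BaxterBipolar

namespace BaxterBipolar

section

/-! ### Baxter permutations of the integers -/

/-! The whole statement rests on one local relation in the diagram. `Corner f d d'` says that the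
quadrant at the corner of the rectangle spanned by the two points contains only points beyond the
opposite corner. The horizontal direction of the quadrant comes from the sign of `d'`, its vertical
direction from the sign of `d`. For a Baxter permutation this relation describes the rotation system
of `Φ(π)`: every half-edge except the two at the marked corners has a `Corner` predecessor
(`IntBaxter.exists_corner`, cut down to the diagram in `pole_or_exists_finCorner`), and that
predecessor is the half-edge just before it in clockwise order (`FinCorner.rotation_eq`).

The relation is visibly compatible with the symmetries of the square. Transposing the diagram swaps
the roles of `d` and `d'` and keeps the signs (`Corner.inv`), so the rotation of `Φ(π⁻¹)` is the
inverse of that of `Φ(π)`: the mirror image. Reversing the diagram changes the sign of `d'` only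
(`FinCorner.rev`), so rotating in `Φ(rev π)` amounts to rotating in `Φ(π)` and then changing halves,
which is a walk around faces: the mirror of the dual. The two remaining half-edges are computed
directly (`rotation_bottom`, `rotation_top`); the transposition in `cutFaceNext` is exactly what
they require. The rotated permutation `rho π` is the inverse of `rev π`, so its case is a
composition.

To link `Corner` with the drawing, one shows that every point has exactly one white neighbour on
each side. Existence propagates along corners; uniqueness uses the Baxter condition
(`IntBaxter.below_unique`). The neighbours of a white vertex on one side form an antichain, so
ordering by argument is ordering by abscissa.

In the bipolar axioms, abscissas increase along edges, which gives acyclicity, and following corners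
leads to the poles. For Euler's formula, vertices are the ascents of `π`, while faces are the
vertices of `Φ(rev π)` with the two poles identified; positions `0, ..., n` split into ascents and
descents. -/

/-- The Baxter condition for permutations of `ℤ`. -/
def IntBaxter (f : Equiv.Perm ℤ) : Prop :=
  ∀ i j k : ℤ, i < j → j + 1 < k →
    ¬ (f (j + 1) < f i ∧ f i < f k ∧ f k < f j) ∧ ¬ (f j < f k ∧ f k < f i ∧ f i < f (j + 1))

/-- `x ↦ - f x`. -/
def negVal (f : Equiv.Perm ℤ) : Equiv.Perm ℤ := f.trans (Equiv.neg ℤ)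

/-- `x ↦ f (- x)`. -/
def negPos (f : Equiv.Perm ℤ) : Equiv.Perm ℤ := (Equiv.neg ℤ).trans f

@[simp] theorem negVal_apply (f : Equiv.Perm ℤ) (x : ℤ) : negVal f x = - f x := rfl

@[simp] theorem negPos_apply (f : Equiv.Perm ℤ) (x : ℤ) : negPos f x = f (- x) := rfl

theorem IntBaxter.negVal {f : Equiv.Perm ℤ} (hf : IntBaxter f) : IntBaxter (negVal f) := by
  intro i j k hij hjk
  have := hf i j k hij hjk
  simp only [negVal_apply, neg_lt_neg_iff]
  exact ⟨fun h => this.2 ⟨h.2.2, h.2.1, h.1⟩, fun h => this.1 ⟨h.2.2, h.2.1, h.1⟩⟩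

theorem IntBaxter.negPos {f : Equiv.Perm ℤ} (hf : IntBaxter f) : IntBaxter (negPos f) := by
  intro i j k hij hjk
  have := hf (-k) (-(j + 1)) (-i) (by omega) (by omega)
  rw [show -(j + 1) + 1 = -j by ring] at this
  simp only [negPos_apply]
  exact ⟨fun h => this.2 h, fun h => this.1 h⟩

theorem exists_crossing (P : ℤ → Prop) {a b : ℤ} (hab : a ≤ b) (ha : P a) (hb : ¬ P b) :
    ∃ j, a ≤ j ∧ j < b ∧ P j ∧ ¬ P (j + 1) := by
  by_contra! h
  have : ∀ x, a ≤ x → x ≤ b → P x := by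
    intro x hx
    induction x, hx using Int.leInduction with
    | base => exact fun _ => ha
    | succ x hx ih => exact fun hxb => h x hx (by omega) (ih (by omega))
  exact hb (this b hab le_rfl)

theorem perm_ne {f : Equiv.Perm ℤ} {x y : ℤ} (h : x ≠ y) : f x ≠ f y := f.injective.ne h

/-- A forbidden pattern of the inverse has two adjacent values at its outer positions. Between the
two inner positions the sequence crosses the gap between these values, and the crossing step
together with the outer positions is a forbidden pattern of `f`. -/
theorem IntBaxter.inv {f : Equiv.Perm ℤ} (hf : IntBaxter f) : IntBaxter f⁻¹ := by
  intro i j k hij hjk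
  obtain ⟨P, hP⟩ := f.surjective (j + 1)
  obtain ⟨Q, hQ⟩ := f.surjective i
  obtain ⟨R, hR⟩ := f.surjective k
  obtain ⟨S, hS⟩ := f.surjective j
  have e1 : f⁻¹ (j + 1) = P := by simp [← hP]
  have e2 : f⁻¹ i = Q := by simp [← hQ]
  have e3 : f⁻¹ k = R := by simp [← hR]
  have e4 : f⁻¹ j = S := by simp [← hS]
  rw [e1, e2, e3, e4]
  constructor
  · rintro ⟨h1, h2, h3⟩
    obtain ⟨x, hx1, hx2, hx3, hx4⟩ := exists_crossing (fun x => f x ≤ j) h2.le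
      (by omega) (by omega)
    have n1 : f x ≠ f S := perm_ne (by omega)
    have n2 : f (x + 1) ≠ f P := perm_ne (by omega)
    exact (hf P x S (by omega) (by omega)).2 ⟨by omega, by omega, by omega⟩
  · rintro ⟨h1, h2, h3⟩
    obtain ⟨x, hx1, hx2, hx3, hx4⟩ := exists_crossing (fun x => j < f x) h2.le
      (by omega) (by omega)
    have n1 : f x ≠ f P := perm_ne (by omega)
    have n2 : f (x + 1) ≠ f S := perm_ne (by omega)
    exact (hf S x P (by omega) (by omega)).1 ⟨by omega, by omega, by omega⟩

/-! ### Corners -/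

/-- The sign attached to a half of an edge. -/
def sgn (b : Bool) : ℤ := if b then 1 else -1

@[simp] theorem sgn_true : sgn true = 1 := rfl
@[simp] theorem sgn_false : sgn false = -1 := rfl
theorem sgn_not (b : Bool) : sgn (!b) = - sgn b := by cases b <;> rfl

/-- In the extended drawing of `f`, the half-edge `d'` follows `d` in clockwise order: in the
rectangle spanned by the two points, the corner `(d'.1, f d.1)` opens a quadrant in which all the
points lie beyond the opposite corner of the rectangle. -/
def Corner (f : Equiv.Perm ℤ) (d d' : ℤ × Bool) : Prop :=
  sgn d'.2 * d'.1 < sgn d'.2 * d.1 ∧ sgn d.2 * f d.1 < sgn d.2 * f d'.1 ∧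
    ∀ k, sgn d'.2 * d'.1 < sgn d'.2 * k → sgn d.2 * f d.1 < sgn d.2 * f k →
      sgn d'.2 * d.1 < sgn d'.2 * k ∧ sgn d.2 * f d'.1 < sgn d.2 * f k

/-- Transposition exchanges abscissas with ordinates, hence the half-edge that gives the horizontal
sign with the one that gives the vertical sign. -/
theorem Corner.inv {f : Equiv.Perm ℤ} {p i : ℤ} {β γ : Bool} (h : Corner f (p, β) (i, γ)) :
    Corner f⁻¹ (f i, γ) (f p, β) := by
  obtain ⟨h1, h2, h3⟩ := h
  refine ⟨h2, by simpa using h1, fun k hk1 hk2 => ?_⟩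
  obtain ⟨k, rfl⟩ := f.surjective k
  have := h3 k (by simpa using hk2) hk1
  simpa using this.symm

theorem Corner.of_negVal {f : Equiv.Perm ℤ} {p i : ℤ} {β γ : Bool}
    (h : Corner (negVal f) (p, β) (i, γ)) : Corner f (p, !β) (i, γ) := by
  simpa [Corner, sgn_not] using h

theorem Corner.of_negPos {f : Equiv.Perm ℤ} {p i : ℤ} {β γ : Bool}
    (h : Corner (negPos f) (p, β) (i, γ)) : Corner f (-p, β) (-i, !γ) := by
  obtain ⟨h1, h2, h3⟩ := h
  refine ⟨by simpa [sgn_not] using h1, h2, fun k hk1 hk2 => ?_⟩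
  have := h3 (-k) (by simpa [sgn_not] using hk1) (by simpa using hk2)
  simpa [sgn_not] using this

/-- The witness is the highest point among those to the right of `i` and below it. By maximality, a
point to the right of `i` and above `p` is also above `i`; the Baxter condition puts it to the right
of `p`. -/
theorem IntBaxter.exists_corner_of_descent {f : Equiv.Perm ℤ} (hf : IntBaxter f) {i : ℤ}
    (hi : f (i + 1) < f i) : ∃ p, Corner f (p, true) (i, true) := by
  obtain ⟨m, ⟨p, hip, rfl, hm⟩, hmax⟩ := Int.exists_greatest_of_bdd
    (P := fun m => ∃ p, i < p ∧ f p = m ∧ m < f i)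
    ⟨f i, fun z hz => by obtain ⟨p, -, -, h⟩ := hz; exact h.le⟩ ⟨f (i + 1), i + 1, by omega, rfl, hi⟩
  refine ⟨p, by simpa using hip, by simpa using hm, fun k hk1 hk2 => ?_⟩
  simp only [sgn_true, one_mul] at hk1 hk2 ⊢
  have above : ∀ k, i < k → f p < f k → f i < f k := by
    intro k hk1 hk2
    by_contra hk
    have : f k ≠ f i := perm_ne (by omega)
    have := hmax (f k) ⟨k, hk1, rfl, by omega⟩
    omega
  refine ⟨?_, above k hk1 hk2⟩
  by_contra hkp
  have hkne : k ≠ p := by rintro rfl; omega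
  -- If `k` were left of `p`, the sequence would jump over `f p` somewhere in between, hence also
  -- over `f i`: a forbidden pattern at `i, x, x + 1, p`.
  obtain ⟨x, hx1, hx2, hx3, hx4⟩ := exists_crossing (fun x => f x ≤ f p) (a := i + 1) (b := k)
    (by omega) (hmax _ ⟨i + 1, by omega, rfl, hi⟩) (by omega)
  have n1 : f x ≠ f p := perm_ne (by omega)
  have := above (x + 1) (by omega) (by omega)
  exact (hf i x p (by omega) (by omega)).2 ⟨by omega, by omega, by omega⟩

theorem IntBaxter.exists_corner_of_ascent {f : Equiv.Perm ℤ} (hf : IntBaxter f) {i : ℤ}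
    (hi : f i < f (i + 1)) : ∃ p, Corner f (p, false) (i, true) := by
  obtain ⟨p, hp⟩ := hf.negVal.exists_corner_of_descent (i := i) (by simpa using hi)
  exact ⟨p, hp.of_negVal⟩

theorem IntBaxter.exists_corner {f : Equiv.Perm ℤ} (hf : IntBaxter f) (d : ℤ × Bool) :
    ∃ c, Corner f c d := by
  have key : ∀ {f : Equiv.Perm ℤ}, IntBaxter f → ∀ i, ∃ p β, Corner f (p, β) (i, true) := by
    intro f hf i
    have : f i ≠ f (i + 1) := perm_ne (by omega)
    rcases this.lt_or_gt with h | h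
    · obtain ⟨p, hp⟩ := hf.exists_corner_of_ascent h
      exact ⟨p, _, hp⟩
    · obtain ⟨p, hp⟩ := hf.exists_corner_of_descent h
      exact ⟨p, _, hp⟩
  obtain ⟨i, γ⟩ := d
  cases γ
  · obtain ⟨p, β, h⟩ := key hf.negPos (-i)
    exact ⟨(-p, β), by simpa using h.of_negPos⟩
  · obtain ⟨p, β, h⟩ := key hf i
    exact ⟨(p, β), h⟩

/-! ### White vertices and their neighbours -/

/-- `f` has an ascent at `a`, and the white vertex of abscissa `a + 1/2` has ordinate
`l + 1/2`. -/
structure IsWhite (f : Equiv.Perm ℤ) (a l : ℤ) : Prop where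
  le : f a ≤ l
  lt : l < f (a + 1)
  left : ∀ k ≤ a, f k < f (a + 1) → f k ≤ l
  right : ∀ k, a < k → f a < f k → l < f k

/-- The point of abscissa `i` lies to the South-West of `(a + 1/2, l + 1/2)`, with no point in
between. -/
structure Below (f : Equiv.Perm ℤ) (i a l : ℤ) : Prop where
  pos : i ≤ a
  val : f i ≤ l
  cov : ∀ k, i < k → k ≤ a → f i < f k → l < f k

/-- The point of abscissa `i` lies to the North-East of `(a + 1/2, l + 1/2)`, with no point in
between. -/
structure Above (f : Equiv.Perm ℤ) (i a l : ℤ) : Prop where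
  pos : a < i
  val : l < f i
  cov : ∀ k, k < i → a < k → f k < f i → f k ≤ l

variable {f : Equiv.Perm ℤ} {a c i k l m p : ℤ}

theorem IsWhite.half_turn (h : IsWhite f a l) :
    IsWhite (negVal (negPos f)) (-(a + 1)) (-(l + 1)) where
  le := by have := h.lt; simp; omega
  lt := by have := h.le; simp; omega
  left k hk hk' := by
    have := h.right (-k) (by omega) (by simpa using hk')
    simp only [negVal_apply, negPos_apply]; omega
  right k hk hk' := by
    have := h.left (-k) (by omega) (by simpa using hk')
    simp only [negVal_apply, negPos_apply]; omega

theorem Above.half_turn (h : Above f i a l) :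
    Below (negVal (negPos f)) (-i) (-(a + 1)) (-(l + 1)) where
  pos := by have := h.pos; omega
  val := by have := h.val; simp; omega
  cov k hk hk' hk'' := by
    have := h.cov (-k) (by omega) (by omega) (by simpa using hk'')
    simp only [negVal_apply, negPos_apply]; omega

/-- With two upper neighbours at `a < c`, the point at `a + 1` is above level `m` and the point at
`c` is not. The descent through level `m` in between must fall below `f i`, which creates a
forbidden pattern. -/
theorem IntBaxter.below_unique (hf : IntBaxter f) (ha : IsWhite f a l) (hc : IsWhite f c m)
    (hia : Below f i a l) (hic : Below f i c m) : a = c := by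
  have key : ∀ {a c l m : ℤ}, IsWhite f a l → IsWhite f c m → Below f i a l → Below f i c m →
      ¬ a < c := by
    intro a c l m ha hc hia hic hac
    have h1 := hic.cov (a + 1) (by have := hia.pos; omega) (by omega)
      (by have := hia.val; have := ha.lt; omega)
    -- The last entry of the pattern is the value just above the level `m`; it occurs to the right
    -- of `c` because all the values at or before `c` that are below `f (c + 1)` are at most `m`.
    obtain ⟨q, hq⟩ := f.surjective (m + 1)
    have hqc : c < q := by
      by_contra hqc
      have hne : f q ≠ f (c + 1) := perm_ne (by omega)
      have := hc.lt
      have := hc.left q (by omega) (by omega)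
      omega
    obtain ⟨x, hx1, hx2, hx3, hx4⟩ := exists_crossing (fun x => m < f x) (a := a + 1) (b := c)
      (by omega) h1 (by have := hc.le; omega)
    have hx : f (x + 1) < f i := by
      by_contra hx
      have hne : f (x + 1) ≠ f i := perm_ne (by have := hia.pos; omega)
      have := hic.cov (x + 1) (by have := hia.pos; omega) (by omega) (by omega)
      exact hx4 this
    have hne : f x ≠ f q := perm_ne (by omega)
    have := hic.val
    exact (hf i x q (by have := hia.pos; omega) (by omega)).1 ⟨hx, by omega, by omega⟩
  exact le_antisymm (not_lt.1 (key hc ha hic hia)) (not_lt.1 (key ha hc hia hic))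

theorem IntBaxter.above_unique (hf : IntBaxter f) (ha : IsWhite f a l) (hc : IsWhite f c m)
    (hia : Above f i a l) (hic : Above f i c m) : a = c := by
  have := hf.negPos.negVal.below_unique ha.half_turn hc.half_turn hia.half_turn hic.half_turn
  omega

theorem IsWhite.below (h : IsWhite f a l) : Below f a a l :=
  ⟨le_rfl, h.le, fun k h1 h2 => by omega⟩

theorem IsWhite.above (h : IsWhite f a l) : Above f (a + 1) a l :=
  ⟨by omega, h.lt, fun k h1 h2 => by omega⟩

/-- The corner sends any obstruction between `i` and the white vertex beyond `p`, where it would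
already obstruct `p`. This carries upper neighbours from `p` to `i`. -/
theorem Corner.below_of_below (h : Corner f (p, true) (i, true)) (ha : IsWhite f a l)
    (hp : Below f p a l) : Below f i a l := by
  obtain ⟨h1, h2, h3⟩ := h
  simp only [sgn_true, one_mul] at h1 h2 h3
  have := hp.pos
  have := hp.val
  have := ha.lt
  have := (h3 (a + 1) (by omega) (by omega)).2
  refine ⟨by omega, ha.left i (by omega) this, fun k hk1 hk2 hk3 => ?_⟩
  have := h3 k hk1 (by omega)
  exact hp.cov k this.1 hk2 (by omega)

theorem Corner.above_of_above (h : Corner f (p, false) (i, false)) (ha : IsWhite f a l)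
    (hp : Above f p a l) : Above f i a l := by
  obtain ⟨h1, h2, h3⟩ := h
  simp only [sgn_false, neg_mul, one_mul, neg_lt_neg_iff] at h1 h2 h3
  have := hp.pos
  have := hp.val
  have := ha.le
  have := (h3 a (by omega) (by omega)).2
  refine ⟨by omega, ha.right i (by omega) this, fun k hk1 hk2 hk3 => ?_⟩
  have := h3 k hk1 (by omega)
  exact hp.cov k this.1 hk2 (by omega)

theorem Corner.ascent_of_false_true (h : Corner f (p, false) (i, true)) : f i < f (i + 1) := by
  obtain ⟨h1, h2, h3⟩ := h
  simp only [sgn_false, sgn_true, neg_mul, one_mul, neg_lt_neg_iff] at h1 h2 h3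
  by_contra hi
  have := h3 (i + 1) (by omega) (by omega)
  omega

theorem Corner.above_of_false_true (h : Corner f (p, false) (i, true)) (hi : IsWhite f i l) :
    Above f p i l := by
  obtain ⟨h1, h2, h3⟩ := h
  simp only [sgn_false, sgn_true, neg_mul, one_mul, neg_lt_neg_iff] at h1 h2 h3
  refine ⟨h1, hi.right p h1 h2, fun k hk1 hk2 hk3 => ?_⟩
  have := h3 k hk2 hk3
  omega

theorem Corner.ascent_of_true_false (h : Corner f (p, true) (i, false)) : f (i - 1) < f i := by
  obtain ⟨h1, h2, h3⟩ := h
  simp only [sgn_false, sgn_true, neg_mul, one_mul, neg_lt_neg_iff] at h1 h2 h3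
  by_contra hi
  have := h3 (i - 1) (by omega) (by omega)
  omega

theorem Corner.below_of_true_false (h : Corner f (p, true) (i, false))
    (hi : IsWhite f (i - 1) l) : Below f p (i - 1) l := by
  obtain ⟨h1, h2, h3⟩ := h
  simp only [sgn_false, sgn_true, neg_mul, one_mul, neg_lt_neg_iff] at h1 h2 h3
  have hl := hi.left p (by omega) (by simpa using h2)
  refine ⟨by omega, hl, fun k hk1 hk2 hk3 => ?_⟩
  have := h3 k (by omega) hk3
  omega

/-- The sequence must jump over the value `f i` between `i` and `k`, and the white vertex of that
ascent separates the two points. Hence no black vertex covers another. -/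
theorem exists_white_between (hik : i < k) (hf : f i < f k) :
    ∃ j, i ≤ j ∧ j < k ∧ f j < f (j + 1) ∧ ∀ l, IsWhite f j l → f i ≤ l ∧ l < f k := by
  obtain ⟨j, h1, h2, h3, h4⟩ := exists_crossing (fun x => f x ≤ f i) hik.le le_rfl (by omega)
  exact ⟨j, h1, h2, by omega, fun l hl => ⟨hl.left i h1 (by omega), hl.right k h2 (by omega)⟩⟩

theorem Below.not_lt (hi : Below f i a l) (hk : Below f k a l) (hik : i < k) : f k < f i := by
  by_contra h
  have : f i ≠ f k := perm_ne (by omega)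
  have := hi.cov k hik hk.pos (by omega)
  have := hk.val
  omega

theorem Above.not_lt (hi : Above f i a l) (hk : Above f k a l) (hik : i < k) : f k < f i := by
  by_contra h
  have : f i ≠ f k := perm_ne (by omega)
  have := hk.cov i hik hi.pos (by omega)
  have := hi.val
  omega

end

section

variable {n : ℕ} {π : Equiv.Perm (Fin n)}

/-! ### The extension of a permutation to the integers -/

/-- The numbering of `Fin n` by `1, ..., n`. -/
def number (n : ℕ) : Fin n ≃ {x : ℤ // 1 ≤ x ∧ x ≤ n} where
  toFun i := ⟨i + 1, by have := i.2; omega⟩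
  invFun x := ⟨(x.1 - 1).toNat, by have := x.2; omega⟩
  left_inv i := by ext; simp
  right_inv x := by have := x.2; ext; simp; omega

/-- The extension of `π` by the identity, with the usual numbering from `1` to `n`. -/
def extend (π : Equiv.Perm (Fin n)) : Equiv.Perm ℤ := π.extendDomain (number n)

theorem extend_coe (π : Equiv.Perm (Fin n)) (i : Fin n) :
    extend π ((i : ℤ) + 1) = (π i : ℤ) + 1 :=
  π.extendDomain_apply_image (number n) i

theorem extend_of_not_mem (π : Equiv.Perm (Fin n)) {x : ℤ} (hx : ¬ (1 ≤ x ∧ x ≤ n)) :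
    extend π x = x :=
  π.extendDomain_apply_not_subtype (number n) hx

theorem extend_inv (π : Equiv.Perm (Fin n)) : extend π⁻¹ = (extend π)⁻¹ :=
  (π.extendDomain_inv (number n)).symm

theorem exists_fin {x : ℤ} (hx : 1 ≤ x ∧ x ≤ n) : ∃ i : Fin n, x = (i : ℤ) + 1 :=
  ⟨⟨(x - 1).toNat, by omega⟩, by simp; omega⟩

theorem extend_mem (π : Equiv.Perm (Fin n)) {x : ℤ} (hx : 1 ≤ x ∧ x ≤ n) :
    1 ≤ extend π x ∧ extend π x ≤ n := by
  obtain ⟨i, rfl⟩ := exists_fin hx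
  rw [extend_coe]
  have := (π i).2
  omega

/-- Inversions never involve the fixed points outside the diagram, so extending by the identity
creates no forbidden pattern. -/
theorem mem_of_inversion {x y : ℤ} (hxy : x < y) (h : extend π y < extend π x) :
    (1 ≤ x ∧ x ≤ n) ∧ 1 ≤ y ∧ y ≤ n := by
  by_cases hx : 1 ≤ x ∧ x ≤ n <;> by_cases hy : 1 ≤ y ∧ y ≤ n
  · exact ⟨hx, hy⟩
  · rw [extend_of_not_mem π hy] at h
    have := extend_mem π hx
    omega
  · rw [extend_of_not_mem π hx] at h
    have := extend_mem π hy
    omega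
  · rw [extend_of_not_mem π hx, extend_of_not_mem π hy] at h
    omega

theorem isBaxter_iff : IsBaxter π ↔ IntBaxter (extend π) := by
  constructor
  · intro h i j k hij hjk
    constructor
    · intro hv
      obtain ⟨hj, hj'⟩ := mem_of_inversion (π := π) (x := j) (y := j + 1) (by omega) (by omega)
      obtain ⟨hi, -⟩ := mem_of_inversion (π := π) (x := i) (y := j + 1) (by omega) (by omega)
      obtain ⟨-, hk⟩ := mem_of_inversion (π := π) (x := j) (y := k) (by omega) (by omega)
      obtain ⟨i, rfl⟩ := exists_fin hi
      obtain ⟨k, rfl⟩ := exists_fin hk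
      obtain ⟨j', hj'⟩ := exists_fin hj'
      obtain ⟨j, rfl⟩ := exists_fin hj
      rw [hj'] at hv
      simp only [extend_coe] at hv
      exact h ⟨i, j, j', k, by omega, by omega, by omega, Or.inl (by omega)⟩
    · intro hv
      obtain ⟨hj, hk⟩ := mem_of_inversion (π := π) (x := j + 1) (y := k) (by omega) (by omega)
      obtain ⟨hi, hj'⟩ := mem_of_inversion (π := π) (x := i) (y := j) (by omega) (by omega)
      obtain ⟨i, rfl⟩ := exists_fin hi
      obtain ⟨k, rfl⟩ := exists_fin hk
      obtain ⟨j', hj⟩ := exists_fin hj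
      obtain ⟨j, rfl⟩ := exists_fin hj'
      rw [hj] at hv
      simp only [extend_coe] at hv
      exact h ⟨i, j, j', k, by omega, by omega, by omega, Or.inr (by omega)⟩
  · rintro h ⟨i, j, j', k, hij, hjk, hj, hv⟩
    have hk : j' ≠ k := by rintro rfl; omega
    have := h (i + 1) (j + 1) (k + 1) (by omega) (by omega)
    rw [show ((j : ℤ) + 1 + 1) = (j' : ℤ) + 1 by omega] at this
    simp only [extend_coe] at this
    omega

theorem IsBaxter.inv (h : IsBaxter π) : IsBaxter π⁻¹ := by
  rw [isBaxter_iff, extend_inv] at *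
  exact h.inv

theorem IsBaxter.isBaxter_rev (h : IsBaxter π) : IsBaxter (rev π) := by
  rintro ⟨i, j, j', k, hij, hjk, hj, hv⟩
  have hk : j' ≠ k := by rintro rfl; omega
  refine h ⟨k.rev, j'.rev, j.rev, i.rev, ?_, ?_, ?_, hv.symm⟩
  · rw [Fin.rev_lt_rev]; omega
  · rw [Fin.rev_lt_rev]; omega
  · simp only [Fin.val_rev]; omega

theorem rho_eq (π : Equiv.Perm (Fin n)) : rho π = (rev π)⁻¹ := by
  rw [rho, rev, mul_inv_rev]
  rfl

/-! ### White vertices -/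

theorem value_eq (π : Equiv.Perm (Fin n)) {k : ℕ} (hk : k ≤ n + 1) :
    (value π k : ℤ) = extend π k := by
  unfold value
  split_ifs with h0 h1
  · subst h0
    rw [extend_of_not_mem π (by simp)]
  · have := extend_coe π ⟨k - 1, h1⟩
    rw [show (((⟨k - 1, h1⟩ : Fin n) : ℕ) : ℤ) + 1 = (k : ℤ) by simp; omega] at this
    rw [this]
    push_cast
    rfl
  · rw [extend_of_not_mem π (by omega)]
    omega

theorem isAscent_iff {a : ℕ} : IsAscent π a ↔ a ≤ n ∧ extend π a < extend π ((a : ℤ) + 1) := by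
  refine and_congr_right fun ha => ?_
  rw [← Nat.cast_lt (α := ℤ), value_eq π (by omega), value_eq π (by omega)]
  rfl

theorem IsAscent.isWhite (hπ : IntBaxter (extend π)) {a : ℕ} (ha : IsAscent π a) :
    IsWhite (extend π) a (level π a) := by
  obtain ⟨han, hlt⟩ := isAscent_iff.1 ha
  have hnat : value π a < value π (a + 1) := ha.2
  have mem : ∀ k : ℕ, k ≤ a → value π k < value π (a + 1) → value π k ≤ level π a :=
    fun k hk hk' => Finset.le_sup (f := value π)
      (Finset.mem_filter.2 ⟨Finset.mem_range.2 (by omega), hk'⟩)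
  obtain ⟨q, hq, hql⟩ := Finset.exists_mem_eq_sup
    ((Finset.range (a + 1)).filter (fun i => value π i < value π (a + 1)))
    ⟨a, Finset.mem_filter.2 ⟨Finset.mem_range.2 (by omega), hnat⟩⟩ (value π)
  simp only [Finset.mem_filter, Finset.mem_range] at hq
  have hql : level π a = value π q := hql
  have ea := value_eq π (k := a) (by omega)
  have ea1 := value_eq π (k := a + 1) (by omega)
  have eq := value_eq π (k := q) (by omega)
  push_cast at ea1
  have hle := mem a le_rfl hnat
  have hleft : ∀ k ≤ (a : ℤ), extend π k < extend π ((a : ℤ) + 1) →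
      extend π k ≤ level π a := by
    intro k hk hk'
    rcases lt_or_ge k 0 with h0 | h0
    · rw [extend_of_not_mem π (by omega)]
      omega
    · lift k to ℕ using h0
      have ek := value_eq π (k := k) (by omega)
      have := mem k (by omega) (by omega)
      omega
  refine ⟨by omega, by omega, hleft, fun k hk hk' => ?_⟩
  by_contra hkl
  have n1 : extend π k ≠ extend π q := perm_ne (by omega)
  have n2 : (q : ℤ) ≠ a := by intro h; rw [h] at eq; omega
  have n3 : k ≠ (a : ℤ) + 1 := by rintro rfl; omega
  -- Only this half of `IsWhite` needs the Baxter condition: `q` realises the level, and a value to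
  -- the right lying between `f a` and the level would complete a forbidden pattern.
  exact (hπ q a k (by omega) (by omega)).2 ⟨hk', by omega, by omega⟩

theorem isAscent_zero (π : Equiv.Perm (Fin n)) : IsAscent π 0 :=
  ⟨Nat.zero_le _, by simp only [value]; split_ifs <;> simp_all⟩

theorem extend_zero (π : Equiv.Perm (Fin n)) : extend π 0 = 0 := extend_of_not_mem π (by omega)

theorem extend_last (π : Equiv.Perm (Fin n)) : extend π ((n : ℤ) + 1) = n + 1 :=
  extend_of_not_mem π (by omega)

theorem le_of_extend_lt {x : ℤ} (hx : x < n + 1) : extend π x < n + 1 := by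
  by_cases h : 1 ≤ x ∧ x ≤ n
  · have := extend_mem π h
    omega
  · rw [extend_of_not_mem π h]
    omega

theorem isAscent_last (π : Equiv.Perm (Fin n)) : IsAscent π n := by
  rw [isAscent_iff, extend_last]
  exact ⟨le_rfl, le_of_extend_lt (by omega)⟩

theorem level_zero (π : Equiv.Perm (Fin n)) : level π 0 = 0 := by
  unfold level
  rw [← Nat.bot_eq_zero, Finset.sup_eq_bot_iff]
  simp [value]

theorem level_last (hπ : IntBaxter (extend π)) : level π n = n := by
  have h := (isAscent_last π).isWhite hπ
  have h1 := h.lt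
  rw [extend_last] at h1
  obtain ⟨q, hq⟩ := (extend π).surjective n
  have hqn : q ≤ n := by
    by_contra hqn
    rw [extend_of_not_mem π (by omega)] at hq
    omega
  have := h.left q hqn (by rw [extend_last, hq]; omega)
  omega

/-! ### The order of the black and white vertices -/

theorem black_le_white {i : Fin n} {a : ℕ} : black π i ≤ white π a ↔
    (i : ℤ) + 1 ≤ a ∧ extend π ((i : ℤ) + 1) ≤ level π a := by
  have key : ∀ x y : ℕ, (x : ℝ) + 1 ≤ (y : ℝ) + 1 / 2 ↔ (x : ℤ) + 1 ≤ y := by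
    intro x y
    rw [show (x : ℝ) + 1 ≤ (y : ℝ) + 1 / 2 ↔ (2 : ℝ) * x + 2 ≤ 2 * y + 1 by
      constructor <;> intro h <;> linarith]
    norm_cast
    omega
  rw [Prod.le_def, extend_coe, ← key, ← key]
  rfl

theorem white_le_black {i : Fin n} {a : ℕ} : white π a ≤ black π i ↔
    (a : ℤ) < (i : ℤ) + 1 ∧ (level π a : ℤ) < extend π ((i : ℤ) + 1) := by
  have key : ∀ x y : ℕ, (y : ℝ) + 1 / 2 ≤ (x : ℝ) + 1 ↔ (y : ℤ) < (x : ℤ) + 1 := by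
    intro x y
    rw [show (y : ℝ) + 1 / 2 ≤ (x : ℝ) + 1 ↔ (2 : ℝ) * y + 1 ≤ 2 * x + 2 by
      constructor <;> intro h <;> linarith]
    norm_cast
    omega
  rw [Prod.le_def, extend_coe, ← key, ← key]
  rfl

theorem black_ne_white {i : Fin n} {a : ℕ} : black π i ≠ white π a := by
  intro h
  have h1 := black_le_white.1 h.le
  have h2 := white_le_black.1 h.ge
  omega

theorem black_le_black {i k : Fin n} : black π i ≤ black π k ↔
    (i : ℤ) ≤ k ∧ extend π ((i : ℤ) + 1) ≤ extend π ((k : ℤ) + 1) := by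
  rw [Prod.le_def, extend_coe, extend_coe]
  simp [black]

theorem white_injective {a c : ℕ} (h : white π a = white π c) : a = c := by
  have := congrArg Prod.fst h
  simpa [white] using this

/-- The white vertex `w_a` covers `b_i`. -/
def IsUpper (π : Equiv.Perm (Fin n)) (i : Fin n) (a : ℕ) : Prop :=
  IsAscent π a ∧ Below (extend π) ((i : ℤ) + 1) a (level π a)

/-- The white vertex `w_a` is covered by `b_i`. -/
def IsLower (π : Equiv.Perm (Fin n)) (i : Fin n) (a : ℕ) : Prop :=
  IsAscent π a ∧ Above (extend π) ((i : ℤ) + 1) a (level π a)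

/-- When the signs agree the two points form an inversion, so `p` lies in the diagram. When they
differ, a point `p` outside the diagram would leave the horizontal neighbour of `i` in the forbidden
part of the quadrant. -/
theorem exists_corner_fin (hπ : IntBaxter (extend π)) {i : Fin n} {γ : Bool}
    (hi : (if γ then (i : ℕ) + 1 < n else 0 < (i : ℕ))) :
    ∃ (p : Fin n) (β : Bool), Corner (extend π) ((p : ℤ) + 1, β) ((i : ℤ) + 1, γ) := by
  obtain ⟨⟨p, β⟩, hp⟩ := hπ.exists_corner ((i : ℤ) + 1, γ)
  suffices h : 1 ≤ p ∧ p ≤ n by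
    obtain ⟨p, rfl⟩ := exists_fin h
    exact ⟨p, β, hp⟩
  obtain ⟨h1, h2, h3⟩ := hp
  have hf := extend_mem π (x := (i : ℤ) + 1) (by omega)
  cases γ <;> cases β <;>
    simp only [sgn_false, sgn_true, neg_mul, one_mul, neg_lt_neg_iff] at h1 h2 h3 hi
  · exact (mem_of_inversion h1 h2).1
  · by_contra hp
    have hp' := extend_of_not_mem π hp
    have := extend_mem π (x := i) (by simp at hi; omega)
    have := h3 i (by omega) (by omega)
    omega
  · by_contra hp
    have hp' := extend_of_not_mem π hp
    have := extend_mem π (x := (i : ℤ) + 2) (by simp at hi; omega)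
    have := h3 (i + 2) (by omega) (by omega)
    omega
  · exact (mem_of_inversion h1 h2).2

/-- At an ascent the adjacent white vertex works. At a descent the corner leads to a point further
right, whose upper neighbour is shared. -/
theorem exists_isUpper (hπ : IntBaxter (extend π)) (i : Fin n) : ∃ a, IsUpper π i a := by
  induction hd : n - (i : ℕ) using Nat.strong_induction_on generalizing i with
  | _ d ih =>
  have asc : extend π ((i : ℤ) + 1) < extend π ((i : ℤ) + 1 + 1) → ∃ a, IsUpper π i a := by
    intro h
    have ha : IsAscent π (i + 1) := isAscent_iff.2 ⟨i.2, by push_cast; exact h⟩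
    exact ⟨i + 1, ha, by simpa using (ha.isWhite hπ).below⟩
  by_cases hi : (i : ℕ) + 1 < n
  · obtain ⟨p, β, hp⟩ := exists_corner_fin hπ (i := i) (γ := true) (by simpa using hi)
    cases β
    · exact asc hp.ascent_of_false_true
    · have hip : (i : ℤ) + 1 < (p : ℤ) + 1 := by simpa using hp.1
      obtain ⟨a, ha, hpa⟩ := ih (n - p) (by omega) p rfl
      exact ⟨a, ha, hp.below_of_below (ha.isWhite hπ) hpa⟩
  · apply asc
    rw [show (i : ℤ) + 1 = n by omega, extend_last]
    exact le_of_extend_lt (by omega)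

theorem exists_isLower (hπ : IntBaxter (extend π)) (i : Fin n) : ∃ a, IsLower π i a := by
  induction hd : (i : ℕ) using Nat.strong_induction_on generalizing i with
  | _ d ih =>
  have asc : extend π i < extend π ((i : ℤ) + 1) → ∃ a, IsLower π i a := by
    intro h
    have ha : IsAscent π i := isAscent_iff.2 ⟨i.2.le, h⟩
    exact ⟨i, ha, (ha.isWhite hπ).above⟩
  by_cases hi : 0 < (i : ℕ)
  · obtain ⟨p, β, hp⟩ := exists_corner_fin hπ (i := i) (γ := false) (by simpa using hi)
    cases β
    · have hip : (p : ℤ) + 1 < (i : ℤ) + 1 := by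
        have := hp.1
        simp only [sgn_false, neg_mul, one_mul, neg_lt_neg_iff] at this
        exact this
      obtain ⟨a, ha, hpa⟩ := ih p (by omega) p rfl
      exact ⟨a, ha, hp.above_of_above (ha.isWhite hπ) hpa⟩
    · apply asc
      have := hp.ascent_of_true_false
      rwa [add_sub_cancel_right] at this
  · apply asc
    rw [show (i : ℤ) = 0 by omega, extend_zero]
    exact (extend_mem π (by omega)).1

theorem IsUpper.unique (hπ : IntBaxter (extend π)) {i : Fin n} {a c : ℕ} (ha : IsUpper π i a)
    (hc : IsUpper π i c) : a = c := by
  exact_mod_cast hπ.below_unique (ha.1.isWhite hπ) (hc.1.isWhite hπ) ha.2 hc.2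

theorem IsLower.unique (hπ : IntBaxter (extend π)) {i : Fin n} {a c : ℕ} (ha : IsLower π i a)
    (hc : IsLower π i c) : a = c := by
  exact_mod_cast hπ.above_unique (ha.1.isWhite hπ) (hc.1.isWhite hπ) ha.2 hc.2

/-- A white point, as a vertex of `φ(π)`. -/
noncomputable def whiteVertex {a : ℕ} (ha : IsAscent π a) : Points π :=
  ⟨white π a, Or.inr ⟨a, ha, rfl⟩⟩

theorem exists_whiteVertex_between (hπ : IntBaxter (extend π)) {i k : Fin n}
    (h : black π i < black π k) :
    ∃ a, ∃ ha : IsAscent π a, blackVertex π i < whiteVertex ha ∧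
      whiteVertex ha < blackVertex π k := by
  obtain ⟨h1, h2⟩ := black_le_black.1 h.le
  have hne : (i : ℤ) ≠ k := by
    intro e
    have : i = k := by ext; exact_mod_cast e
    exact h.ne (by rw [this])
  have hne' : extend π ((i : ℤ) + 1) ≠ extend π ((k : ℤ) + 1) := perm_ne (by omega)
  obtain ⟨j, hj1, hj2, hj3, hj⟩ := exists_white_between (f := extend π) (i := (i : ℤ) + 1)
    (k := (k : ℤ) + 1) (by omega) (by omega)
  lift j to ℕ using by omega
  have ha : IsAscent π j := isAscent_iff.2 ⟨by omega, hj3⟩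
  obtain ⟨hl1, hl2⟩ := hj _ (ha.isWhite hπ)
  exact ⟨j, ha, lt_of_le_of_ne (black_le_white.2 ⟨hj1, hl1⟩) fun e =>
    black_ne_white (congrArg Subtype.val e), lt_of_le_of_ne (white_le_black.2 ⟨hj2, hl2⟩) fun e =>
    black_ne_white (congrArg Subtype.val e).symm⟩

/-- Only black vertices in between are excluded. Together with uniqueness this also rules out white
ones in `blackVertex_covBy_iff`. -/
theorem isUpper_of_covBy {i : Fin n} {a : ℕ} (ha : IsAscent π a)
    (h : ∀ k, blackVertex π i < blackVertex π k → ¬ blackVertex π k < whiteVertex ha)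
    (hi : blackVertex π i < whiteVertex ha) : IsUpper π i a := by
  obtain ⟨h1, h2⟩ := black_le_white.1 hi.le
  refine ⟨ha, h1, h2, fun k hk1 hk2 hk3 => ?_⟩
  by_contra hk4
  obtain ⟨k, rfl⟩ := exists_fin (n := n) (x := k) ⟨by omega, by have := ha.1; omega⟩
  refine h k (lt_of_le_of_ne (black_le_black.2 ⟨by omega, hk3.le⟩) fun e => ?_)
    (lt_of_le_of_ne (black_le_white.2 ⟨hk2, by omega⟩) fun e =>
      black_ne_white (congrArg Subtype.val e))
  have := congrArg (fun v : Points π => v.1.1) e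
  simp [blackVertex, black] at this
  omega

theorem isLower_of_covBy {i : Fin n} {a : ℕ} (ha : IsAscent π a)
    (h : ∀ k, blackVertex π k < blackVertex π i → ¬ whiteVertex ha < blackVertex π k)
    (hi : whiteVertex ha < blackVertex π i) : IsLower π i a := by
  obtain ⟨h1, h2⟩ := white_le_black.1 hi.le
  refine ⟨ha, h1, h2, fun k hk1 hk2 hk3 => ?_⟩
  by_contra hk4
  obtain ⟨k, rfl⟩ := exists_fin (n := n) (x := k) ⟨by omega, by omega⟩
  refine h k (lt_of_le_of_ne (black_le_black.2 ⟨by omega, hk3.le⟩) fun e => ?_)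
    (lt_of_le_of_ne (white_le_black.2 ⟨hk2, by omega⟩) fun e =>
      black_ne_white (congrArg Subtype.val e).symm)
  have := congrArg (fun v : Points π => v.1.1) e
  simp [blackVertex, black] at this
  omega

theorem blackVertex_covBy_iff (hπ : IntBaxter (extend π)) {i : Fin n} {a : ℕ}
    (ha : IsUpper π i a) (v : Points π) : blackVertex π i ⋖ v ↔ (v : ℝ × ℝ) = white π a := by
  constructor
  · rintro hv
    obtain ⟨v, ⟨k, rfl⟩ | ⟨c, hc, rfl⟩⟩ := v
    · obtain ⟨c, hc, h1, h2⟩ := exists_whiteVertex_between hπ (i := i) (k := k) hv.1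
      exact absurd h2 (hv.2 h1)
    · rw [ha.unique hπ (isUpper_of_covBy hc (fun k h1 => hv.2 h1) hv.1)]
  · intro hv
    obtain rfl : v = whiteVertex ha.1 := Subtype.ext hv
    refine ⟨lt_of_le_of_ne (black_le_white.2 ⟨ha.2.pos, ha.2.val⟩) fun e =>
      black_ne_white (congrArg Subtype.val e), ?_⟩
    have key : ∀ k, blackVertex π i < blackVertex π k →
        ¬ blackVertex π k < whiteVertex ha.1 := by
      intro k h1 h2
      obtain ⟨h3, h4⟩ := black_le_black.1 h1.le
      obtain ⟨h5, h6⟩ := black_le_white.1 h2.le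
      have hne : (i : ℤ) ≠ k := by
        intro e
        have : i = k := by ext; exact_mod_cast e
        exact h1.ne (by rw [this])
      have hne' : extend π ((i : ℤ) + 1) ≠ extend π ((k : ℤ) + 1) := perm_ne (by omega)
      have := ha.2.cov _ (by omega) h5 (by omega)
      omega
    rintro ⟨v, ⟨k, rfl⟩ | ⟨c, hc, rfl⟩⟩ h1 h2
    · exact key k h1 h2
    · have := ha.unique hπ (isUpper_of_covBy hc (fun k h3 h4 => key k h3 (h4.trans h2)) h1)
      subst this
      exact h2.ne rfl

theorem covBy_blackVertex_iff (hπ : IntBaxter (extend π)) {i : Fin n} {a : ℕ}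
    (ha : IsLower π i a) (v : Points π) : v ⋖ blackVertex π i ↔ (v : ℝ × ℝ) = white π a := by
  constructor
  · rintro hv
    obtain ⟨v, ⟨k, rfl⟩ | ⟨c, hc, rfl⟩⟩ := v
    · obtain ⟨c, hc, h1, h2⟩ := exists_whiteVertex_between hπ (i := k) (k := i) hv.1
      exact absurd h2 (hv.2 h1)
    · rw [ha.unique hπ (isLower_of_covBy hc (fun k h1 h2 => hv.2 h2 h1) hv.1)]
  · intro hv
    obtain rfl : v = whiteVertex ha.1 := Subtype.ext hv
    refine ⟨lt_of_le_of_ne (white_le_black.2 ⟨ha.2.pos, ha.2.val⟩) fun e =>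
      black_ne_white (congrArg Subtype.val e).symm, ?_⟩
    have key : ∀ k, blackVertex π k < blackVertex π i →
        ¬ whiteVertex ha.1 < blackVertex π k := by
      intro k h1 h2
      obtain ⟨h3, h4⟩ := black_le_black.1 h1.le
      obtain ⟨h5, h6⟩ := white_le_black.1 h2.le
      have hne : (k : ℤ) ≠ i := by
        intro e
        have : k = i := by ext; exact_mod_cast e
        exact h1.ne (by rw [this])
      have hne' : extend π ((k : ℤ) + 1) ≠ extend π ((i : ℤ) + 1) := perm_ne (by omega)
      have := ha.2.cov _ (by omega) h5 (by omega)
      omega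
    rintro ⟨v, ⟨k, rfl⟩ | ⟨c, hc, rfl⟩⟩ h1 h2
    · exact key k h2 h1
    · have := ha.unique hπ (isLower_of_covBy hc (fun k h3 h4 => key k h3 (h1.trans h4)) h2)
      subst this
      exact h1.ne rfl

theorem IsBaxter.blackDegreesOne (h : IsBaxter π) : BlackDegreesOne π := by
  have hπ := isBaxter_iff.1 h
  intro i
  obtain ⟨a, ha⟩ := exists_isLower hπ i
  obtain ⟨c, hc⟩ := exists_isUpper hπ i
  exact ⟨⟨a, ha.1, covBy_blackVertex_iff hπ ha⟩, c, hc.1, blackVertex_covBy_iff hπ hc⟩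

/-! ### Endpoints of the half-edges -/

theorem IsUpper.endpoint_eq (hπ : IntBaxter (extend π)) {i : Fin n} {a : ℕ}
    (ha : IsUpper π i a) : endpoint π (i, true) = white π a := by
  have := Classical.epsilon_spec (p := fun v : Points π => blackVertex π i ⋖ v)
    ⟨whiteVertex ha.1, (blackVertex_covBy_iff hπ ha _).2 rfl⟩
  exact (blackVertex_covBy_iff hπ ha _).1 this

theorem IsLower.endpoint_eq (hπ : IntBaxter (extend π)) {i : Fin n} {a : ℕ}
    (ha : IsLower π i a) : endpoint π (i, false) = white π a := by
  have := Classical.epsilon_spec (p := fun v : Points π => v ⋖ blackVertex π i)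
    ⟨whiteVertex ha.1, (covBy_blackVertex_iff hπ ha _).2 rfl⟩
  exact (covBy_blackVertex_iff hπ ha _).1 this

theorem endpoint_true_iff (hπ : IntBaxter (extend π)) {i : Fin n} {a : ℕ} :
    endpoint π (i, true) = white π a ↔ IsUpper π i a := by
  refine ⟨fun h => ?_, fun h => h.endpoint_eq hπ⟩
  obtain ⟨c, hc⟩ := exists_isUpper hπ i
  rwa [← white_injective ((hc.endpoint_eq hπ).symm.trans h)]

theorem endpoint_false_iff (hπ : IntBaxter (extend π)) {i : Fin n} {a : ℕ} :
    endpoint π (i, false) = white π a ↔ IsLower π i a := by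
  refine ⟨fun h => ?_, fun h => h.endpoint_eq hπ⟩
  obtain ⟨c, hc⟩ := exists_isLower hπ i
  rwa [← white_injective ((hc.endpoint_eq hπ).symm.trans h)]

theorem exists_endpoint_eq (hπ : IntBaxter (extend π)) (d : Dart (Fin n)) :
    ∃ a, IsAscent π a ∧ endpoint π d = white π a := by
  obtain ⟨i, _ | _⟩ := d
  · obtain ⟨a, ha⟩ := exists_isLower hπ i
    exact ⟨a, ha.1, ha.endpoint_eq hπ⟩
  · obtain ⟨a, ha⟩ := exists_isUpper hπ i
    exact ⟨a, ha.1, ha.endpoint_eq hπ⟩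

end

section

variable {n : ℕ} {π : Equiv.Perm (Fin n)}

/-! ### The clockwise order of the half-edges around a vertex -/

theorem arg_lt_arg_of_pos {x₁ y₁ x₂ y₂ : ℝ} (hx₁ : 0 < x₁) (hx : x₁ < x₂) (hy₂ : 0 < y₂)
    (hy : y₂ < y₁) : Complex.arg ⟨x₂, y₂⟩ < Complex.arg ⟨x₁, y₁⟩ := by
  have h1 := Complex.abs_arg_lt_pi_div_two_iff.2 (Or.inl (show 0 < (⟨x₁, y₁⟩ : ℂ).re from hx₁))
  have h2 := Complex.abs_arg_lt_pi_div_two_iff.2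
    (Or.inl (show 0 < (⟨x₂, y₂⟩ : ℂ).re from hx₁.trans hx))
  rw [abs_lt] at h1 h2
  by_contra! h
  have ht : Real.tan (Complex.arg ⟨x₁, y₁⟩) ≤ Real.tan (Complex.arg ⟨x₂, y₂⟩) := by
    rcases h.eq_or_lt with h | h
    · rw [h]
    · exact (Real.tan_lt_tan_of_lt_of_lt_pi_div_two h1.1 h2.2 h).le
  rw [Complex.tan_arg, Complex.tan_arg, div_le_div_iff₀ hx₁ (hx₁.trans hx)] at ht
  dsimp only at ht
  nlinarith

theorem arg_lt_arg_of_neg {x₁ y₁ x₂ y₂ : ℝ} (hx₁ : x₁ < 0) (hx : x₂ < x₁) (hy₂ : y₂ < 0)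
    (hy : y₁ < y₂) : Complex.arg ⟨x₂, y₂⟩ < Complex.arg ⟨x₁, y₁⟩ := by
  have h := arg_lt_arg_of_pos (neg_pos.2 hx₁) (neg_lt_neg hx) (neg_pos.2 hy₂) (neg_lt_neg hy)
  have e : ∀ x y : ℝ, y < 0 →
      Complex.arg ⟨x, y⟩ = Complex.arg ⟨-x, -y⟩ - Real.pi := by
    intro x y hy
    rw [← Complex.arg_neg_eq_arg_sub_pi_of_im_pos (x := ⟨-x, -y⟩) (neg_pos.2 hy)]
    congr 1
    apply Complex.ext <;> simp
  rw [e _ _ hy₂, e _ _ (hy.trans hy₂)]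
  linarith

/-- A number that increases clockwise around each vertex of `φ(π)`, starting from the West. -/
def clock (d : Dart (Fin n)) : ℤ := if d.2 then 2 * n - d.1 else d.1

@[simp] theorem clock_true (i : Fin n) : clock (i, true) = 2 * n - i := rfl
@[simp] theorem clock_false (i : Fin n) : clock (i, false) = i := rfl

theorem clock_injective : Function.Injective (clock : Dart (Fin n) → ℤ) := by
  rintro ⟨i, _ | _⟩ ⟨k, _ | _⟩ h <;> simp only [clock_true, clock_false] at h
  · have : i = k := by ext; omega
    rw [this]
  · omega
  · omega
  · have : i = k := by ext; omega
    rw [this]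

theorem angle_of_endpoint {d : Dart (Fin n)} {a : ℕ} (h : endpoint π d = white π a) :
    angle π d = Complex.arg ⟨(black π d.1).1 - (white π a).1,
      (black π d.1).2 - (white π a).2⟩ := by
  rw [angle, h]

theorem white_lt_black_coords {i : Fin n} {a : ℕ} (h : white π a ≤ black π i) :
    (white π a).1 < (black π i).1 ∧ (white π a).2 < (black π i).2 := by
  have key : ∀ x y : ℕ, (y : ℝ) + 1 / 2 ≤ (x : ℝ) + 1 → (y : ℝ) + 1 / 2 < (x : ℝ) + 1 := by
    intro x y h
    have h' : (2 : ℝ) * y + 1 ≤ 2 * x + 2 := by linarith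
    have h2 : 2 * y + 1 < 2 * x + 2 := by
      have : 2 * y + 1 ≤ 2 * x + 2 := by exact_mod_cast h'
      omega
    have h3 : (2 : ℝ) * y + 1 < 2 * x + 2 := by exact_mod_cast h2
    linarith
  exact ⟨key _ _ h.1, key _ _ h.2⟩

theorem black_lt_white_coords {i : Fin n} {a : ℕ} (h : black π i ≤ white π a) :
    (black π i).1 < (white π a).1 ∧ (black π i).2 < (white π a).2 := by
  have key : ∀ x y : ℕ, (x : ℝ) + 1 ≤ (y : ℝ) + 1 / 2 → (x : ℝ) + 1 < (y : ℝ) + 1 / 2 := by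
    intro x y h
    have h' : (2 : ℝ) * x + 2 ≤ 2 * y + 1 := by linarith
    have h2 : 2 * x + 2 < 2 * y + 1 := by
      have : 2 * x + 2 ≤ 2 * y + 1 := by exact_mod_cast h'
      omega
    have h3 : (2 : ℝ) * x + 2 < 2 * y + 1 := by exact_mod_cast h2
    linarith
  exact ⟨key _ _ h.1, key _ _ h.2⟩

theorem IsUpper.black_le {i : Fin n} {a : ℕ} (h : IsUpper π i a) : black π i ≤ white π a :=
  black_le_white.2 ⟨h.2.pos, h.2.val⟩

theorem IsLower.le_black {i : Fin n} {a : ℕ} (h : IsLower π i a) : white π a ≤ black π i :=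
  white_le_black.2 ⟨h.2.pos, h.2.val⟩

theorem black_coords_lt {i k : Fin n} (hik : (i : ℤ) < k)
    (hv : extend π ((k : ℤ) + 1) < extend π ((i : ℤ) + 1)) :
    (black π i).1 < (black π k).1 ∧ (black π k).2 < (black π i).2 := by
  simp only [extend_coe] at hv
  constructor
  · have : (i : ℕ) < k := by omega
    simpa [black] using this
  · have : (π k : ℕ) < π i := by omega
    simpa [black] using this

/-- The neighbours on one side of a white vertex form a decreasing chain, so arguments are ordered
by abscissas there. Outgoing half-edges have nonnegative argument and ingoing ones negative
argument. -/
theorem angle_lt_of_clock_lt (hπ : IntBaxter (extend π)) {d d' : Dart (Fin n)}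
    (he : endpoint π d = endpoint π d') (h : clock d < clock d') : angle π d' < angle π d := by
  obtain ⟨a, -, hd'⟩ := exists_endpoint_eq hπ d'
  have hd := he.trans hd'
  rw [angle_of_endpoint hd, angle_of_endpoint hd']
  obtain ⟨i, _ | _⟩ := d <;> obtain ⟨k, _ | _⟩ := d' <;>
    simp only [clock_true, clock_false] at h <;>
    simp only [endpoint_false_iff hπ, endpoint_true_iff hπ] at hd hd'
  · have hb := black_coords_lt h (hd.2.not_lt hd'.2 (by omega))
    have h1 := white_lt_black_coords hd.le_black
    have h2 := white_lt_black_coords hd'.le_black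
    exact arg_lt_arg_of_pos (by linarith) (by linarith) (by linarith) (by linarith)
  · have h1 := white_lt_black_coords hd.le_black
    have h2 := black_lt_white_coords hd'.black_le
    have h3 := Complex.arg_neg_iff (z := ⟨(black π k).1 - (white π a).1,
      (black π k).2 - (white π a).2⟩) |>.2 (by simp only; linarith)
    have h4 := Complex.arg_nonneg_iff (z := ⟨(black π i).1 - (white π a).1,
      (black π i).2 - (white π a).2⟩) |>.2 (by simp only; linarith)
    exact h3.trans_le h4
  · omega
  · have hb := black_coords_lt (i := k) (k := i) (by omega) (hd'.2.not_lt hd.2 (by omega))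
    have h1 := black_lt_white_coords hd.black_le
    have h2 := black_lt_white_coords hd'.black_le
    exact arg_lt_arg_of_neg (by linarith) (by linarith) (by linarith) (by linarith)

theorem nodup_dartsAt (π : Equiv.Perm (Fin n)) (v : ℝ × ℝ) : (dartsAt π v).Nodup :=
  (List.perm_insertionSort _ _).nodup_iff.2 (Finset.nodup_toList _)

theorem pairwise_dartsAt (hπ : IntBaxter (extend π)) (v : ℝ × ℝ) :
    (dartsAt π v).Pairwise (fun d d' => clock d < clock d') := by
  classical
  have : Std.Total (fun d d' : Dart (Fin n) => angle π d' ≤ angle π d) :=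
    ⟨fun d d' => le_total _ _⟩
  have : IsTrans (Dart (Fin n)) (fun d d' => angle π d' ≤ angle π d) :=
    ⟨fun _ _ _ h h' => h'.trans h⟩
  have h1 : (dartsAt π v).Pairwise (fun d d' => angle π d' ≤ angle π d) :=
    List.pairwise_insertionSort _ _
  refine (h1.and (nodup_dartsAt π v)).imp_of_mem ?_
  rintro d d' hd hd' ⟨h2, h3⟩
  rw [mem_dartsAt] at hd hd'
  rcases lt_trichotomy (clock d) (clock d') with h | h | h
  · exact h
  · exact absurd (clock_injective h) h3
  · exact absurd (angle_lt_of_clock_lt hπ (hd'.trans hd.symm) h) (not_lt.2 h2)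

theorem clock_getElem_lt (hπ : IntBaxter (extend π)) {v : ℝ × ℝ} {i j : ℕ}
    (hi : i < (dartsAt π v).length) (hj : j < (dartsAt π v).length) :
    clock (dartsAt π v)[i] < clock (dartsAt π v)[j] ↔ i < j := by
  have h := List.pairwise_iff_getElem.1 (pairwise_dartsAt hπ v)
  refine ⟨fun hlt => ?_, h i j hi hj⟩
  by_contra! hji
  rcases hji.eq_or_lt with rfl | hji
  · exact lt_irrefl _ hlt
  · exact (h j i hj hi hji).not_gt hlt

theorem rotation_eq_of_consecutive (hπ : IntBaxter (extend π)) {d d' : Dart (Fin n)}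
    (he : endpoint π d = endpoint π d') (hlt : clock d < clock d')
    (hc : ∀ e, endpoint π e = endpoint π d → clock d < clock e → clock d' ≤ clock e) :
    rotation π d = d' := by
  set v := endpoint π d with hv
  obtain ⟨i, hi, hid⟩ := List.getElem_of_mem ((mem_dartsAt π v d).2 rfl)
  obtain ⟨j, hj, hjd⟩ := List.getElem_of_mem ((mem_dartsAt π v d').2 he.symm)
  have hij : i < j := by rw [← clock_getElem_lt hπ hi hj, hid, hjd]; exact hlt
  have h1 : i + 1 < (dartsAt π v).length := by omega
  have hji : j = i + 1 := by
    by_contra hne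
    have h2 := hc _ ((mem_dartsAt π v _).1 (List.getElem_mem h1))
      (by rw [← hid, clock_getElem_lt hπ]; omega)
    rw [← hjd, ← not_lt, clock_getElem_lt hπ] at h2
    omega
  have h3 : rotation π d = (dartsAt π v).formPerm d := rfl
  subst hji
  rw [h3, ← hid, List.formPerm_apply_lt_getElem _ (nodup_dartsAt π v) i h1, hjd]

theorem rotation_eq_of_last (hπ : IntBaxter (extend π)) {d d' : Dart (Fin n)}
    (he : endpoint π d = endpoint π d')
    (h1 : ∀ e, endpoint π e = endpoint π d → clock e ≤ clock d)
    (h2 : ∀ e, endpoint π e = endpoint π d → clock d' ≤ clock e) : rotation π d = d' := by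
  set v := endpoint π d with hv
  obtain ⟨i, hi, hid⟩ := List.getElem_of_mem ((mem_dartsAt π v d).2 rfl)
  obtain ⟨j, hj, hjd⟩ := List.getElem_of_mem ((mem_dartsAt π v d').2 he.symm)
  have hi' : i + 1 = (dartsAt π v).length := by
    by_contra hne
    have hi1 : i + 1 < (dartsAt π v).length := by omega
    have := h1 _ ((mem_dartsAt π v _).1 (List.getElem_mem hi1))
    rw [← hid, ← not_lt, clock_getElem_lt hπ] at this
    omega
  have hj' : j = 0 := by
    by_contra hne
    have hi1 : 0 < (dartsAt π v).length := by omega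
    have := h2 _ ((mem_dartsAt π v _).1 (List.getElem_mem hi1))
    rw [← hjd, ← not_lt, clock_getElem_lt hπ] at this
    omega
  have h3 : rotation π d = (dartsAt π v).formPerm d := rfl
  subst hj'
  rw [h3, ← hid, List.formPerm_apply_getElem _ (nodup_dartsAt π v) i hi]
  simp only [hi', Nat.mod_self, hjd]

theorem headD_dartsAt (hπ : IntBaxter (extend π)) {d d₀ : Dart (Fin n)} {v : ℝ × ℝ}
    (hd : endpoint π d = v) (h : ∀ e, endpoint π e = v → clock d ≤ clock e) :
    (dartsAt π v).headD d₀ = d := by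
  have hmem := (mem_dartsAt π v d).2 hd
  have hp := pairwise_dartsAt hπ v
  have hm := fun e => (mem_dartsAt π v e).1
  cases hl : dartsAt π v with
  | nil => simp [hl] at hmem
  | cons b l =>
    rw [hl] at hmem hp hm
    rcases List.mem_cons.1 hmem with rfl | hmem
    · rfl
    · have h1 := (List.pairwise_cons.1 hp).1 d hmem
      have h2 := h b (hm b (List.mem_cons_self))
      omega

theorem rotation_of_endpoint {d : Dart (Fin n)} {v : ℝ × ℝ} (h : endpoint π d = v) :
    rotation π d = (dartsAt π v).formPerm d := by
  subst h
  rfl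

theorem rotation_sameCycle_of_endpoint_eq {d d' : Dart (Fin n)}
    (h : endpoint π d = endpoint π d') : (rotation π).SameCycle d d' := by
  set v := endpoint π d with hv
  have key : ∀ k (hk : k < (dartsAt π v).length), (rotation π).SameCycle
      ((dartsAt π v)[0]'(by omega)) (dartsAt π v)[k] := by
    intro k
    induction k with
    | zero => exact fun _ => Equiv.Perm.SameCycle.refl _ _
    | succ k ih =>
      intro hk
      have h1 := List.formPerm_apply_lt_getElem _ (nodup_dartsAt π v) k hk
      have hk' : k < (dartsAt π v).length := by omega
      have h2 : endpoint π ((dartsAt π v)[k]) = v := (mem_dartsAt π v _).1 (List.getElem_mem hk')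
      have h3 : rotation π (dartsAt π v)[k] = (dartsAt π v)[k + 1] := by
        rw [← h1]
        exact rotation_of_endpoint h2
      rw [← h3]
      exact (Equiv.Perm.sameCycle_apply_right).2 (ih hk')
  obtain ⟨i, hi, hid⟩ := List.getElem_of_mem ((mem_dartsAt π v d).2 rfl)
  obtain ⟨j, hj, hjd⟩ := List.getElem_of_mem ((mem_dartsAt π v d').2 h.symm)
  rw [← hid, ← hjd]
  exact (key i hi).symm.trans (key j hj)

theorem endpoint_rotation (d : Dart (Fin n)) : endpoint π (rotation π d) = endpoint π d :=
  endpoint_formPerm π d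

theorem eq_of_sameCycle {α β : Type*} {σ : Equiv.Perm α} {g : α → β} (hg : ∀ x, g (σ x) = g x)
    {x y : α} (h : σ.SameCycle x y) : g x = g y := by
  obtain ⟨k, rfl⟩ := h
  induction k with
  | zero => rfl
  | succ k ih => rw [add_comm, zpow_add, zpow_one, Equiv.Perm.mul_apply, hg, ih]
  | pred k ih => rw [← hg ((σ ^ (-(k : ℤ) - 1)) x), ← Equiv.Perm.mul_apply, mul_self_zpow,
      sub_add_cancel, ih]

theorem endpoint_eq_of_sameCycle {d d' : Dart (Fin n)} (h : (rotation π).SameCycle d d') :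
    endpoint π d = endpoint π d' :=
  eq_of_sameCycle endpoint_rotation h

/-! ### Corners and rotation -/

/-- `Corner`, for half-edges of `Φ(π)`. -/
def FinCorner (π : Equiv.Perm (Fin n)) (d d' : Dart (Fin n)) : Prop :=
  Corner (extend π) ((d.1 : ℤ) + 1, d.2) ((d'.1 : ℤ) + 1, d'.2)

/-- Equal signs give consecutive half-edges on the same side of a vertex. Opposite signs give the
passage from the last outgoing to the first ingoing half-edge, or back. In each case the emptiness
of the quadrant excludes a half-edge in between. -/
theorem FinCorner.rotation_eq (hπ : IntBaxter (extend π)) {d d' : Dart (Fin n)}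
    (h : FinCorner π d d') : rotation π d = d' := by
  obtain ⟨p, β⟩ := d
  obtain ⟨i, γ⟩ := d'
  have hc : Corner (extend π) ((p : ℤ) + 1, β) ((i : ℤ) + 1, γ) := h
  obtain ⟨h1, h2, h3⟩ := h
  cases β <;> cases γ <;>
    simp only [sgn_false, sgn_true, neg_mul, one_mul, neg_lt_neg_iff] at h1 h2 h3
  · obtain ⟨a, hp⟩ := exists_isLower hπ p
    have hi : IsLower π i a := ⟨hp.1, hc.above_of_above (hp.1.isWhite hπ) hp.2⟩
    have ep := hp.endpoint_eq hπ
    refine rotation_eq_of_consecutive hπ (ep.trans (hi.endpoint_eq hπ).symm)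
      (by simp; omega) ?_
    rintro ⟨k, _ | _⟩ he hk <;> rw [ep] at he <;>
      simp only [endpoint_false_iff hπ, endpoint_true_iff hπ] at he <;>
      simp only [clock_true, clock_false] at hk ⊢
    · by_contra hki
      have h4 := hp.2.not_lt he.2 (by omega)
      have h5 := he.2.not_lt hi.2 (by omega)
      have := h3 (k + 1) (by omega) h4
      omega
    · omega
  · have ha : IsAscent π (i + 1) := isAscent_iff.2 ⟨i.2, by
      push_cast; exact hc.ascent_of_false_true⟩
    have hp : IsLower π p (i + 1) :=
      ⟨ha, by simpa using hc.above_of_false_true (by simpa using ha.isWhite hπ)⟩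
    have hi : IsUpper π i (i + 1) := ⟨ha, by simpa using (ha.isWhite hπ).below⟩
    have ep := hp.endpoint_eq hπ
    refine rotation_eq_of_consecutive hπ (ep.trans (hi.endpoint_eq hπ).symm)
      (by simp; omega) ?_
    rintro ⟨k, _ | _⟩ he hk <;> rw [ep] at he <;>
      simp only [endpoint_false_iff hπ, endpoint_true_iff hπ] at he <;>
      simp only [clock_true, clock_false] at hk ⊢
    · have h4 := hp.2.not_lt he.2 (by omega)
      have h5 := h3 (k + 1) (by omega) h4
      have := hi.2.val
      have := he.2.val
      omega
    · have := he.2.pos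
      push_cast at this
      omega
  · have hi0 : ((i : ℕ) : ℤ) = (i : ℤ) + 1 - 1 := by ring
    have ha : IsAscent π i := isAscent_iff.2 ⟨i.2.le, by
      have := hc.ascent_of_true_false; rwa [← hi0] at this⟩
    have hp : IsUpper π p i := by
      refine ⟨ha, ?_⟩
      have := hc.below_of_true_false (l := level π i) (by rw [← hi0]; exact ha.isWhite hπ)
      rwa [← hi0] at this
    have hi : IsLower π i i := ⟨ha, (ha.isWhite hπ).above⟩
    have ep := hp.endpoint_eq hπ
    -- From ingoing to outgoing half-edges, the rotation passes the West, where the clock starts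
    -- again.
    refine rotation_eq_of_last hπ (ep.trans (hi.endpoint_eq hπ).symm) ?_ ?_ <;>
    rintro ⟨k, _ | _⟩ he <;> rw [ep] at he <;>
      simp only [endpoint_false_iff hπ, endpoint_true_iff hπ] at he <;>
      simp only [clock_true, clock_false]
    · omega
    · by_contra hk
      have h4 := he.2.not_lt hp.2 (by omega)
      have h5 := h3 (k + 1) (by have := he.2.pos; omega) h4
      have := he.2.val
      have := hi.2.val
      omega
    · have := he.2.pos
      omega
    · omega
  · obtain ⟨a, hp⟩ := exists_isUpper hπ p
    have hi : IsUpper π i a := ⟨hp.1, hc.below_of_below (hp.1.isWhite hπ) hp.2⟩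
    have ep := hp.endpoint_eq hπ
    refine rotation_eq_of_consecutive hπ (ep.trans (hi.endpoint_eq hπ).symm)
      (by simp; omega) ?_
    rintro ⟨k, _ | _⟩ he hk <;> rw [ep] at he <;>
      simp only [endpoint_false_iff hπ, endpoint_true_iff hπ] at he <;>
      simp only [clock_true, clock_false] at hk ⊢
    · omega
    · by_contra hki
      have h4 := he.2.not_lt hp.2 (by omega)
      have := h3 (k + 1) (by omega) h4
      omega

theorem FinCorner.inv {d d' : Dart (Fin n)} (h : FinCorner π d d') :
    FinCorner π⁻¹ (π d'.1, d'.2) (π d.1, d.2) := by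
  have := Corner.inv h
  rwa [← extend_inv, extend_coe, extend_coe] at this

/-- The condition on the corner only needs to be checked on the points of the diagram. -/
theorem finCorner_iff {p i : Fin n} {β γ : Bool} : FinCorner π (p, β) (i, γ) ↔
    sgn γ * i < sgn γ * p ∧ sgn β * π p < sgn β * π i ∧
    ∀ k : Fin n, sgn γ * i < sgn γ * k → sgn β * π p < sgn β * π k →
      sgn γ * p < sgn γ * k ∧ sgn β * π i < sgn β * π k := by
  unfold FinCorner Corner
  simp only [extend_coe, mul_add, add_lt_add_iff_right]
  refine and_congr_right fun h1 => and_congr_right fun h2 => ⟨fun h k hk hk' => ?_,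
    fun h k hk hk' => ?_⟩
  · have := h ((k : ℤ) + 1)
    simp only [extend_coe, mul_add, add_lt_add_iff_right] at this
    exact this hk hk'
  · by_cases hkn : 1 ≤ k ∧ k ≤ n
    · obtain ⟨k, rfl⟩ := exists_fin hkn
      simp only [extend_coe, mul_add, add_lt_add_iff_right] at hk hk' ⊢
      exact h k hk hk'
    -- A fixed point outside the diagram is either outside the quadrant or beyond every point of the
    -- diagram.
    · rw [extend_of_not_mem π hkn] at hk' ⊢
      have hp := (π p).2
      have hi := (π i).2
      cases γ <;> cases β <;>
        simp only [sgn_false, sgn_true, neg_mul, one_mul] at * <;> omega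

/-- A reflection of the abscissas reverses only the horizontal sign. The extension by the identity
is not preserved by the reflection, so the argument goes through `finCorner_iff`. -/
theorem FinCorner.rev {d d' : Dart (Fin n)} (h : FinCorner π d d') :
    FinCorner (rev π) (d.1.rev, d.2) (d'.1.rev, !d'.2) := by
  obtain ⟨p, β⟩ := d
  obtain ⟨i, γ⟩ := d'
  rw [finCorner_iff] at *
  have e : ∀ k : Fin n, BaxterBipolar.rev π k = π k.rev := fun k => rfl
  have e' : ∀ k : Fin n, ((k.rev : Fin n) : ℤ) = n - 1 - k := by
    intro k
    rw [Fin.val_rev]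
    omega
  obtain ⟨h1, h2, h3⟩ := h
  refine ⟨?_, ?_, fun k hk hk' => ?_⟩
  · simp only [e', sgn_not]; linarith
  · simpa [e] using h2
  · have := h3 k.rev (by simp only [e', sgn_not] at hk ⊢; linarith) (by simpa [e] using hk')
    simp only [e', e, sgn_not, Fin.rev_rev] at this ⊢
    exact ⟨by linarith [this.1], this.2⟩

theorem exists_finCorner (hπ : IntBaxter (extend π)) (d : Dart (Fin n))
    (hd : if d.2 then (d.1 : ℕ) + 1 < n else 0 < (d.1 : ℕ)) : ∃ c, FinCorner π c d := by
  obtain ⟨p, β, h⟩ := exists_corner_fin hπ (i := d.1) (γ := d.2) hd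
  exact ⟨(p, β), h⟩

end

section

variable {n : ℕ} {π : Equiv.Perm (Fin n)}

theorem perm_apply_inv {α : Type*} (σ : Equiv.Perm α) (x : α) : σ (σ⁻¹ x) = x :=
  σ.apply_symm_apply x

theorem perm_inv_apply {α : Type*} (σ : Equiv.Perm α) (x : α) : σ⁻¹ (σ x) = x :=
  σ.symm_apply_apply x

/-! ### The poles -/

theorem FinCorner.lt_of_false {d : Dart (Fin n)} {i : Fin n} (h : FinCorner π d (i, false)) :
    d.1 < i := by
  have := h.1
  simp only [sgn_false, neg_mul, one_mul] at this
  omega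

theorem FinCorner.lt_of_true {d : Dart (Fin n)} {i : Fin n} (h : FinCorner π d (i, true)) :
    i < d.1 := by
  have := h.1
  simp only [sgn_true, one_mul] at this
  omega

theorem isUpper_last_of (hπ : IntBaxter (extend π)) {i : Fin n}
    (hi : ∀ k : Fin n, i < k → π k < π i) :
    IsUpper π i n := by
  have := (π i).2
  refine ⟨isAscent_last π, by omega, ?_, fun k h1 h2 h3 => ?_⟩
  · rw [level_last hπ, extend_coe]; omega
  · obtain ⟨k, rfl⟩ := exists_fin (n := n) (x := k) ⟨by omega, by omega⟩
    rw [extend_coe, extend_coe] at h3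
    have := hi k (by omega)
    omega

theorem eq_false_of_endpoint_zero (hπ : IntBaxter (extend π)) {e : Dart (Fin n)}
    (he : endpoint π e = white π 0) : ∃ k, e = (k, false) ∧ IsLower π k 0 := by
  obtain ⟨k, _ | _⟩ := e
  · exact ⟨k, rfl, (endpoint_false_iff hπ).1 he⟩
  · have := ((endpoint_true_iff hπ).1 he).2.pos
    push_cast at this
    omega

theorem eq_true_of_endpoint_last (hπ : IntBaxter (extend π)) {e : Dart (Fin n)}
    (he : endpoint π e = white π n) : ∃ k, e = (k, true) ∧ IsUpper π k n := by
  obtain ⟨k, _ | _⟩ := e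
  · have := ((endpoint_false_iff hπ).1 he).2.pos
    omega
  · exact ⟨k, rfl, (endpoint_true_iff hπ).1 he⟩

theorem isLower_zero_of {i : Fin n} (hi : ∀ k : Fin n, k < i → π i < π k) : IsLower π i 0 := by
  refine ⟨isAscent_zero π, by push_cast; omega, ?_, fun k h1 h2 h3 => ?_⟩
  · rw [level_zero, extend_coe]; omega
  · obtain ⟨k, rfl⟩ := exists_fin (n := n) (x := k) ⟨by push_cast at h2; omega, by omega⟩
    rw [extend_coe, extend_coe] at h3
    have := hi k (by omega)
    omega

variable [NeZero n]

theorem val_rev_zero : ((Fin.rev (0 : Fin n) : Fin n) : ℕ) + 1 = n := by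
  have := NeZero.pos n
  rw [Fin.val_rev]
  simp only [Fin.val_zero]
  omega

theorem isLower_first : IsLower π 0 0 :=
  isLower_zero_of fun k hk => absurd hk (Fin.not_lt_zero k)

theorem isLower_bottom : IsLower π (π⁻¹ 0) 0 := by
  refine isLower_zero_of fun k hk => ?_
  rw [perm_apply_inv, Fin.pos_iff_ne_zero]
  rintro h
  rw [← h, perm_inv_apply] at hk
  exact lt_irrefl _ hk

theorem isUpper_last (hπ : IntBaxter (extend π)) : IsUpper π (Fin.rev 0) n := by
  refine isUpper_last_of hπ fun k hk => ?_
  have := val_rev_zero (n := n)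
  omega

theorem isUpper_top (hπ : IntBaxter (extend π)) : IsUpper π (π⁻¹ (Fin.rev 0)) n := by
  refine isUpper_last_of hπ fun k hk => ?_
  have h : π k ≠ Fin.rev 0 := by
    rintro h
    rw [← h, perm_inv_apply] at hk
    exact lt_irrefl _ hk
  rw [perm_apply_inv]
  have := val_rev_zero (n := n)
  omega

/-- At the source all half-edges are outgoing; the leftmost point gives the first one and the lowest
point the last one. -/
theorem rotation_bottom (hπ : IntBaxter (extend π)) :
    rotation π (π⁻¹ 0, false) = (0, false) := by
  have e := (isLower_bottom (π := π)).endpoint_eq hπ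
  refine rotation_eq_of_last hπ (e.trans (isLower_first.endpoint_eq hπ).symm)
    (fun d hd => ?_) (fun d hd => ?_) <;>
  obtain ⟨k, rfl, hk⟩ := eq_false_of_endpoint_zero hπ (hd.trans e)
  · by_contra h
    have := isLower_bottom.2.not_lt hk.2 (by simp only [clock_false] at h; omega)
    rw [extend_coe, extend_coe, perm_apply_inv] at this
    simp only [Fin.val_zero] at this
    omega
  · simp

theorem rotation_top (hπ : IntBaxter (extend π)) :
    rotation π (π⁻¹ (Fin.rev 0), true) = (Fin.rev 0, true) := by
  have e := (isUpper_top hπ).endpoint_eq hπ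
  have hn := val_rev_zero (n := n)
  refine rotation_eq_of_last hπ (e.trans ((isUpper_last hπ).endpoint_eq hπ).symm)
    (fun d hd => ?_) (fun d hd => ?_) <;>
  obtain ⟨k, rfl, hk⟩ := eq_true_of_endpoint_last hπ (hd.trans e)
  · by_contra h
    have := hk.2.not_lt (isUpper_top hπ).2 (by simp only [clock_true] at h; omega)
    rw [extend_coe, extend_coe, perm_apply_inv] at this
    omega
  · simp only [clock_true]
    omega

theorem Phi_src (hπ : IntBaxter (extend π)) : (Phi π).src = (0, false) := by
  refine headD_dartsAt hπ (isLower_first.endpoint_eq hπ) fun e he => ?_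
  obtain ⟨k, rfl, -⟩ := eq_false_of_endpoint_zero hπ he
  simp

theorem Phi_snk (hπ : IntBaxter (extend π)) : (Phi π).snk = (Fin.rev 0, true) := by
  refine headD_dartsAt hπ ((isUpper_last hπ).endpoint_eq hπ) fun e he => ?_
  obtain ⟨k, rfl, -⟩ := eq_true_of_endpoint_last hπ he
  have := val_rev_zero (n := n)
  simp only [clock_true]
  omega

theorem pole_or_exists_finCorner (hπ : IntBaxter (extend π)) (d : Dart (Fin n)) :
    d = (0, false) ∨ d = (Fin.rev 0, true) ∨ ∃ c, FinCorner π c d := by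
  have hn := val_rev_zero (n := n)
  obtain ⟨i, _ | _⟩ := d
  · by_cases hi : i = 0
    · exact Or.inl (by rw [hi])
    · exact Or.inr (Or.inr (exists_finCorner hπ _ (by
        simpa using Fin.pos_iff_ne_zero.2 hi)))
  · by_cases hi : i = Fin.rev 0
    · exact Or.inr (Or.inl (by rw [hi]))
    · refine Or.inr (Or.inr (exists_finCorner hπ _ ?_))
      simp only [if_true]
      omega

/-! ### Mirror images and duals -/

namespace BipolarMap

variable {E F G : Type*}

theorem mir_mir (M : BipolarMap E) : M.mir.mir = M := by
  cases M
  simp [mir]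

theorem IsIso.trans {f : E ≃ F} {g : F ≃ G} {M : BipolarMap E} {N : BipolarMap F}
    {K : BipolarMap G} (hf : IsIso f M N) (hg : IsIso g N K) : IsIso (f.trans g) M K where
  map_rot d := by
    have := hg.map_rot (Prod.map f id d)
    rw [hf.map_rot d] at this
    exact this
  map_src := by rw [hg.map_src, hf.map_src]; rfl
  map_snk := by rw [hg.map_snk, hf.map_snk]; rfl

theorem IsIso.map_rot_inv {f : E ≃ F} {M : BipolarMap E} {N : BipolarMap F}
    (h : IsIso f M N) (d : Dart E) : N.rot⁻¹ (Prod.map f id d) = Prod.map f id (M.rot⁻¹ d) := by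
  rw [Equiv.Perm.inv_eq_iff_eq, h.map_rot, perm_apply_inv]

theorem IsIso.mir {f : E ≃ F} {M : BipolarMap E} {N : BipolarMap F} (h : IsIso f M N) :
    IsIso f M.mir N.mir where
  map_rot := h.map_rot_inv
  map_src := by
    change N.rot⁻¹ N.src = _
    rw [h.map_src, h.map_rot_inv]
    rfl
  map_snk := by
    change N.rot⁻¹ N.snk = _
    rw [h.map_snk, h.map_rot_inv]
    rfl

theorem flip_apply (d : Dart E) : flip E d = (d.1, !d.2) := rfl

theorem flip_mul_flip : flip E * flip E = 1 := by
  ext d <;> simp [flip_apply]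

theorem flip_inv : (flip E)⁻¹ = flip E := inv_eq_of_mul_eq_one_right flip_mul_flip

theorem dual_mir_rot [DecidableEq E] (M : BipolarMap E) :
    M.dual.mir.rot = flip E * Equiv.swap M.src M.snk * M.rot := by
  change (flip E * M.cutFaceNext⁻¹ * flip E)⁻¹ = _
  simp only [mul_inv_rev, inv_inv, flip_inv, cutFaceNext, faceNext, mul_assoc, flip_mul_flip,
    mul_one]

theorem dual_mir_src [DecidableEq E] (M : BipolarMap E) : M.dual.mir.src = flip E M.snk := by
  change M.dual.mir.rot (M.rot⁻¹ M.src) = _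
  simp [dual_mir_rot]

theorem dual_mir_snk [DecidableEq E] (M : BipolarMap E) : M.dual.mir.snk = flip E M.src := by
  change M.dual.mir.rot (M.rot⁻¹ M.snk) = _
  simp [dual_mir_rot]

end BipolarMap

open BipolarMap

/-- Transposition reverses corners, and it exchanges the leftmost point with the lowest one and the
rightmost with the highest, which settles the poles. -/
theorem IsBaxter.isIso_inv (h : IsBaxter π) : IsIso π (Phi π).mir (Phi π⁻¹) := by
  have hπ := isBaxter_iff.1 h
  have hπ' := isBaxter_iff.1 h.inv
  have hb := rotation_bottom hπ'
  have ht := rotation_top hπ'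
  rw [inv_inv] at hb ht
  refine ⟨fun d => ?_, ?_, ?_⟩
  · change rotation π⁻¹ _ = Prod.map π id ((rotation π)⁻¹ d)
    rcases pole_or_exists_finCorner hπ d with rfl | rfl | ⟨c, hc⟩
    · rw [← Equiv.Perm.eq_inv_iff_eq.2 (rotation_bottom hπ)]
      simpa using hb
    · rw [← Equiv.Perm.eq_inv_iff_eq.2 (rotation_top hπ)]
      simpa using ht
    · rw [← Equiv.Perm.eq_inv_iff_eq.2 (hc.rotation_eq hπ)]
      exact hc.inv.rotation_eq hπ'
  · change _ = Prod.map π id ((rotation π)⁻¹ (Phi π).src)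
    rw [Phi_src hπ, Phi_src hπ', ← Equiv.Perm.eq_inv_iff_eq.2 (rotation_bottom hπ)]
    simp
  · change _ = Prod.map π id ((rotation π)⁻¹ (Phi π).snk)
    rw [Phi_snk hπ, Phi_snk hπ', ← Equiv.Perm.eq_inv_iff_eq.2 (rotation_top hπ)]
    simp

theorem IsBaxter.isIso_rev (h : IsBaxter π) :
    IsIso Fin.revPerm (Phi π).dual.mir (Phi (rev π)) := by
  have hπ := isBaxter_iff.1 h
  have hπ' := isBaxter_iff.1 h.isBaxter_rev
  have e : ∀ i, (rev π)⁻¹ i = Fin.rev (π⁻¹ i) := fun i => by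
    rw [rev, mul_inv_rev]; rfl
  refine ⟨fun d => ?_, ?_, ?_⟩
  · rw [dual_mir_rot, Phi_src hπ, Phi_snk hπ]
    change rotation (rev π) _ = Prod.map Fin.revPerm id
      (flip _ (Equiv.swap _ _ (rotation π d)))
    -- The two half-edges without a corner are those moved by the transposition in `cutFaceNext`;
    -- after it they match the poles of `Φ(rev π)`.
    by_cases h0 : rotation π d = (0, false)
    · rw [h0, Equiv.swap_apply_left]
      rw [← rotation_bottom hπ, EmbeddingLike.apply_eq_iff_eq] at h0
      have := rotation_bottom hπ'
      rw [e] at this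
      simpa [h0, flip_apply] using this
    by_cases h1 : rotation π d = (Fin.rev 0, true)
    · rw [h1, Equiv.swap_apply_right]
      rw [← rotation_top hπ, EmbeddingLike.apply_eq_iff_eq] at h1
      have := rotation_top hπ'
      rw [e] at this
      simpa [h1, flip_apply] using this
    obtain ⟨c, hc⟩ := ((pole_or_exists_finCorner hπ (rotation π d)).resolve_left h0).resolve_left h1
    have hcd : c = d := (rotation π).injective (hc.rotation_eq hπ)
    subst hcd
    rw [Equiv.swap_apply_of_ne_of_ne h0 h1]
    exact hc.rev.rotation_eq hπ'
  · rw [dual_mir_src, Phi_snk hπ, Phi_src hπ']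
    simp [flip_apply]
  · rw [dual_mir_snk, Phi_src hπ, Phi_snk hπ']
    simp [flip_apply]

/-- Rotation is reversion followed by inversion, and the two mirror images cancel. The composed
relabelling, reversion of indices followed by `rev π`, is `π`. -/
theorem IsBaxter.isIso_rho (h : IsBaxter π) : IsIso π (Phi π).dual (Phi (rho π)) := by
  have := h.isIso_rev.mir.trans h.isBaxter_rev.isIso_inv
  rw [mir_mir, ← rho_eq] at this
  convert this
  ext i
  simp [rev]

end

section

variable {n : ℕ} {π : Equiv.Perm (Fin n)}

open BipolarMap

/-- The half-edge of `Φ(rev π)` in the corner of a half-edge of `Φ(π)`. -/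
def revFlip (d : Dart (Fin n)) : Dart (Fin n) := (d.1.rev, !d.2)

theorem revFlip_revFlip (d : Dart (Fin n)) : revFlip (revFlip d) = d := by simp [revFlip]

theorem extend_rev {x : ℤ} (hx : 1 ≤ x ∧ x ≤ n) :
    extend (rev π) x = extend π (n + 1 - x) := by
  obtain ⟨i, rfl⟩ := exists_fin hx
  have e : (n : ℤ) + 1 - (i + 1) = ((Fin.rev i : Fin n) : ℤ) + 1 := by
    rw [Fin.val_rev]
    omega
  rw [e, extend_coe, extend_coe]
  rfl

theorem isAscent_rev_iff {a : ℕ} (h0 : 0 < a) (hn : a < n) :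
    IsAscent (rev π) a ↔ ¬ IsAscent π (n - a) := by
  rw [isAscent_iff, isAscent_iff, extend_rev (by omega), extend_rev (by omega)]
  have e : ((n - a : ℕ) : ℤ) = n + 1 - (a + 1) := by omega
  have e' : (n : ℤ) + 1 - (a + 1) + 1 = n + 1 - a := by ring
  rw [e, e']
  have : extend π (n + 1 - (a + 1)) ≠ extend π (n + 1 - a) := perm_ne (by omega)
  omega

variable [NeZero n]

/-! ### `Φ(π)` is a plane bipolar orientation -/

theorem Phi_connected (hπ : IntBaxter (extend π)) (d d' : Dart (Fin n)) :
    ∃ g ∈ Subgroup.closure {(Phi π).rot, flip (Fin n)}, g d = d' := by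
  set H := Subgroup.closure {(Phi π).rot, flip (Fin n)} with hH
  have hrot : rotation π ∈ H := Subgroup.subset_closure (Or.inl rfl)
  have hflip : flip (Fin n) ∈ H := Subgroup.subset_closure (Or.inr rfl)
  have key : ∀ m : ℕ, ∀ i : Fin n, (i : ℕ) = m → ∀ β, ∃ g ∈ H, g (i, β) = (0, false) := by
    intro m
    induction m using Nat.strong_induction_on with
    | _ m ih =>
    intro i hm
    have hfalse : ∃ g ∈ H, g (i, false) = (0, false) := by
      rcases pole_or_exists_finCorner hπ (i, false) with h | h | ⟨c, hc⟩
      · exact ⟨1, H.one_mem, h⟩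
      · simp at h
      · have hlt := hc.lt_of_false
        obtain ⟨g, hg, hgc⟩ := ih c.1 (by omega) c.1 rfl c.2
        refine ⟨g * (rotation π)⁻¹, H.mul_mem hg (H.inv_mem hrot), ?_⟩
        -- Rotating back from an outgoing half-edge reaches an edge with a smaller abscissa, so the
        -- descent ends at `(0, false)`.
        rw [Equiv.Perm.mul_apply, ← hc.rotation_eq hπ, perm_inv_apply]
        exact hgc
    intro β
    cases β
    · exact hfalse
    · obtain ⟨g, hg, hgi⟩ := hfalse
      exact ⟨g * flip _, H.mul_mem hg hflip, hgi⟩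
  obtain ⟨g, hg, hgd⟩ := key d.1 d.1 rfl d.2
  obtain ⟨g', hg', hgd'⟩ := key d'.1 d'.1 rfl d'.2
  refine ⟨g'⁻¹ * g, H.mul_mem (H.inv_mem hg') hg, ?_⟩
  rw [Equiv.Perm.mul_apply, Equiv.Perm.inv_eq_iff_eq]
  exact hgd.trans hgd'.symm

theorem vertex_eq_iff {d d' : Dart (Fin n)} :
    (Phi π).vertex d = (Phi π).vertex d' ↔ endpoint π d = endpoint π d' :=
  ⟨fun h => endpoint_eq_of_sameCycle (Quotient.exact h),
    fun h => Quotient.sound (rotation_sameCycle_of_endpoint_eq h)⟩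

theorem vertex_eq_of_rotation {d d' : Dart (Fin n)} (h : rotation π d = d') :
    (Phi π).vertex d = (Phi π).vertex d' := by
  rw [vertex_eq_iff, ← h, endpoint_rotation]

theorem Phi_acyclic (hπ : IntBaxter (extend π)) (e : Fin n) :
    ¬ Relation.TransGen (fun e₁ e₂ : Fin n =>
      (Phi π).vertex (e₁, true) = (Phi π).vertex (e₂, false)) e e := by
  have step : ∀ e₁ e₂ : Fin n,
      (Phi π).vertex (e₁, true) = (Phi π).vertex (e₂, false) → e₁ < e₂ := by
    intro e₁ e₂ h
    rw [vertex_eq_iff] at h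
    obtain ⟨a, ha⟩ := exists_isUpper hπ e₁
    rw [ha.endpoint_eq hπ, eq_comm, endpoint_false_iff hπ] at h
    have h1 := ha.2.pos
    have h2 := h.2.pos
    omega
  have trans : ∀ e₂, Relation.TransGen (fun e₁ e₂ : Fin n =>
      (Phi π).vertex (e₁, true) = (Phi π).vertex (e₂, false)) e e₂ → e < e₂ := by
    intro e₂ h
    induction h with
    | single h => exact step _ _ h
    | tail _ h ih => exact ih.trans (step _ _ h)
  exact fun h => lt_irrefl _ (trans e h)

theorem Phi_isSource_iff (hπ : IntBaxter (extend π)) (v : (Phi π).Vertex) :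
    (Phi π).IsSource v ↔ v = (Phi π).vertex (Phi π).src := by
  rw [Phi_src hπ]
  constructor
  · have key : ∀ m : ℕ, ∀ i : Fin n, (i : ℕ) = m → (Phi π).IsSource ((Phi π).vertex (i, false)) →
        (Phi π).vertex (i, false) = (Phi π).vertex (0, false) := by
      intro m
      induction m using Nat.strong_induction_on with
      | _ m ih =>
      intro i hm hs
      rcases pole_or_exists_finCorner hπ (i, false) with h | h | ⟨⟨p, _ | _⟩, hc⟩
      · rw [h]
      · simp at h
      · have hlt : p < i := hc.lt_of_false
        rw [← vertex_eq_of_rotation (hc.rotation_eq hπ)] at hs ⊢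
        exact ih p (by omega) p rfl hs
      · exact absurd (vertex_eq_of_rotation (hc.rotation_eq hπ)) (hs p)
    obtain ⟨⟨i, _ | _⟩, rfl⟩ := Quotient.exists_rep v
    · exact key i i rfl
    · exact fun h => absurd rfl (h i)
  · rintro rfl e he
    rw [vertex_eq_iff, isLower_first.endpoint_eq hπ] at he
    obtain ⟨k, hk, -⟩ := eq_false_of_endpoint_zero hπ he
    simp at hk

theorem Phi_isSink_iff (hπ : IntBaxter (extend π)) (v : (Phi π).Vertex) :
    (Phi π).IsSink v ↔ v = (Phi π).vertex (Phi π).snk := by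
  rw [Phi_snk hπ]
  constructor
  · have key : ∀ m : ℕ, ∀ i : Fin n, n - (i : ℕ) = m →
        (Phi π).IsSink ((Phi π).vertex (i, true)) →
        (Phi π).vertex (i, true) = (Phi π).vertex (Fin.rev 0, true) := by
      intro m
      induction m using Nat.strong_induction_on with
      | _ m ih =>
      intro i hm hs
      rcases pole_or_exists_finCorner hπ (i, true) with h | h | ⟨⟨p, _ | _⟩, hc⟩
      · simp at h
      · rw [h]
      · exact absurd (vertex_eq_of_rotation (hc.rotation_eq hπ)) (hs p)
      · have hlt : i < p := hc.lt_of_true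
        rw [← vertex_eq_of_rotation (hc.rotation_eq hπ)] at hs ⊢
        exact ih (n - p) (by omega) p rfl hs
    obtain ⟨⟨i, _ | _⟩, rfl⟩ := Quotient.exists_rep v
    · exact fun h => absurd rfl (h i)
    · exact key _ i rfl
  · rintro rfl e he
    rw [vertex_eq_iff, (isUpper_last hπ).endpoint_eq hπ] at he
    obtain ⟨k, hk, -⟩ := eq_true_of_endpoint_last hπ he
    simp at hk

/-- The face walk from the source follows the left border: its edges are the left-to-right maxima of
`π`, and each corner leads to the next one until the sink is reached. -/
theorem Phi_outer (hπ : IntBaxter (extend π)) :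
    (Phi π).leftFace (Phi π).src = (Phi π).leftFace (Phi π).snk := by
  have key : ∀ m : ℕ, ∀ i : Fin n, n - (i : ℕ) = m → (∀ k < i, π k < π i) →
      (Phi π).faceNext.SameCycle (i, false) (Fin.rev 0, true) := by
    intro m
    induction m using Nat.strong_induction_on with
    | _ m ih =>
    intro i hm hi
    have hnext : (Phi π).faceNext (i, false) = rotation π (i, true) := rfl
    rw [← Equiv.Perm.sameCycle_apply_left, hnext]
    rcases pole_or_exists_finCorner hπ (rotation π (i, true)) with h | h | ⟨c, hc⟩
    · rw [← rotation_bottom hπ, EmbeddingLike.apply_eq_iff_eq] at h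
      simp at h
    · rw [h]
    · obtain rfl : c = (i, true) := (rotation π).injective (hc.rotation_eq hπ)
      generalize rotation π (i, true) = d at hc
      obtain ⟨p, _ | _⟩ := d
      · have hlt : i < p := hc.lt_of_false
        rw [finCorner_iff] at hc
        simp only [sgn_true, sgn_false, neg_mul, one_mul, neg_lt_neg_iff] at hc
        refine ih (n - p) (by omega) p rfl fun k hk => ?_
        by_contra hkp
        have hne : π k ≠ π p := π.injective.ne hk.ne
        have h1 := (hc.2.2 k (by omega) (by omega)).1
        have h2 := hi k (by omega)
        omega
      · rw [finCorner_iff] at hc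
        simp only [sgn_true, one_mul] at hc
        have := hi p (by omega)
        omega
  rw [Phi_src hπ, Phi_snk hπ]
  exact Quotient.sound (key _ 0 rfl fun k hk => absurd hk (Fin.not_lt_zero k))

/-! ### Euler's formula -/

theorem exists_dart (hπ : IntBaxter (extend π)) {a : ℕ} (ha : IsAscent π a) :
    ∃ d, endpoint π d = white π a := by
  rcases ha.1.lt_or_eq with h | h
  · exact ⟨(⟨a, h⟩, false), IsLower.endpoint_eq hπ ⟨ha, (ha.isWhite hπ).above⟩⟩
  · exact ⟨(Fin.rev 0, true), by rw [h]; exact (isUpper_last hπ).endpoint_eq hπ⟩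

theorem card_vertex (hπ : IntBaxter (extend π)) :
    Nat.card (Phi π).Vertex = Nat.card {a // IsAscent π a} := by
  choose d hd using fun a : {a // IsAscent π a} => exists_dart hπ a.2
  refine (Nat.card_congr (Equiv.ofBijective (fun a => (Phi π).vertex (d a)) ⟨?_, ?_⟩)).symm
  · intro a c h
    have h := vertex_eq_iff.1 h
    rw [hd, hd] at h
    exact Subtype.ext (white_injective h)
  · intro v
    obtain ⟨e, rfl⟩ := Quotient.exists_rep v
    obtain ⟨a, ha, he⟩ := exists_endpoint_eq hπ e
    exact ⟨⟨a, ha⟩, vertex_eq_iff.2 ((hd _).trans he.symm)⟩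

theorem IsBaxter.rotation_rev_revFlip (h : IsBaxter π) (d : Dart (Fin n)) :
    rotation (rev π) (revFlip d) = revFlip ((Phi π).cutFaceNext d) := by
  have := h.isIso_rev.map_rot (flip _ d)
  rw [dual_mir_rot] at this
  exact this

/-- The cut face walk is the rotation of `Φ(rev π)`. Cutting splits only the outer face, so faces
are the white vertices of `rev π` with the two poles identified, and omitting `n` selects one
representative of each. -/
theorem IsBaxter.card_face (h : IsBaxter π) :
    Nat.card (Phi π).Face = Nat.card {a // IsAscent (rev π) a ∧ a ≠ n} := by
  classical
  have hπ := isBaxter_iff.1 h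
  have hπ' := isBaxter_iff.1 h.isBaxter_rev
  have hsrc := Phi_src hπ
  have hsnk := Phi_snk hπ
  have houter : (Phi π).faceNext.SameCycle (Phi π).src (Phi π).snk := Quotient.exact (Phi_outer hπ)
  have e0 : endpoint (rev π) (revFlip (Phi π).snk) = white (rev π) 0 := by
    rw [hsnk]
    simpa [revFlip] using isLower_first.endpoint_eq hπ'
  have en : endpoint (rev π) (revFlip (Phi π).src) = white (rev π) n := by
    rw [hsrc]
    simpa [revFlip] using (isUpper_last hπ').endpoint_eq hπ'
  have hswap : ∀ x, (Phi π).faceNext x =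
      Equiv.swap (Phi π).src (Phi π).snk ((Phi π).cutFaceNext x) := by
    intro x
    simp [cutFaceNext]
  have hcut : ∀ x, (Phi π).faceNext.SameCycle x ((Phi π).cutFaceNext x) := by
    intro x
    have hx : (Phi π).faceNext.SameCycle x ((Phi π).faceNext x) :=
      Equiv.Perm.sameCycle_apply_right.2 (Equiv.Perm.SameCycle.refl _ _)
    change (Phi π).faceNext.SameCycle x (Equiv.swap _ _ ((Phi π).faceNext x))
    rw [Equiv.swap_apply_def]
    split_ifs with h1 h2
    · exact (h1 ▸ hx).trans houter
    · exact (h2 ▸ hx).trans houter.symm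
    · exact hx
  have hface : ∀ x y, endpoint (rev π) (revFlip x) = endpoint (rev π) (revFlip y) →
      (Phi π).leftFace x = (Phi π).leftFace y := by
    intro x y hxy
    refine Quotient.sound ?_
    have key := eq_of_sameCycle (g := fun z => (Phi π).leftFace (revFlip z)) (fun z => ?_)
      (rotation_sameCycle_of_endpoint_eq hxy)
    · simp only [revFlip_revFlip] at key
      exact Quotient.exact key
    · obtain ⟨w, rfl⟩ : ∃ w, z = revFlip w := ⟨revFlip z, (revFlip_revFlip z).symm⟩
      rw [h.rotation_rev_revFlip, revFlip_revFlip, revFlip_revFlip]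
      exact Quotient.sound (hcut w).symm
  -- A complete invariant of faces: the endpoint in the drawing of `rev π`, with the sink sent to
  -- the source so that the two parts of the outer face agree.
  let g : Dart (Fin n) → ℝ × ℝ := fun x =>
    if endpoint (rev π) (revFlip x) = white (rev π) n then white (rev π) 0
    else endpoint (rev π) (revFlip x)
  have gsrc : g (Phi π).src = white (rev π) 0 := if_pos en
  have gsnk : g (Phi π).snk = white (rev π) 0 := by
    simp only [g]
    split_ifs
    · rfl
    · exact e0
  have hg : ∀ x, g ((Phi π).faceNext x) = g x := by
    intro x
    have hx : g ((Phi π).cutFaceNext x) = g x := by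
      simp only [g]
      rw [← h.rotation_rev_revFlip, endpoint_rotation]
    rw [hswap, ← hx, Equiv.swap_apply_def]
    split_ifs with h1 h2
    · rw [h1, gsrc, gsnk]
    · rw [h2, gsrc, gsnk]
    · rfl
  choose d hd using fun a : {a // IsAscent (rev π) a ∧ a ≠ n} => exists_dart hπ' a.2.1
  have hgd : ∀ a, g (revFlip (d a)) = white (rev π) a := by
    intro a
    simp only [g, revFlip_revFlip, hd]
    exact if_neg fun e => a.2.2 (white_injective e)
  refine (Nat.card_congr (Equiv.ofBijective
    (fun a => (Phi π).leftFace (revFlip (d a))) ⟨?_, ?_⟩)).symm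
  · intro a c hac
    have := eq_of_sameCycle hg (Quotient.exact hac)
    rw [hgd, hgd] at this
    exact Subtype.ext (white_injective this)
  · intro v
    obtain ⟨x, rfl⟩ := Quotient.exists_rep v
    obtain ⟨a, ha, hx⟩ := exists_endpoint_eq hπ' (revFlip x)
    by_cases han : a = n
    · refine ⟨⟨0, isAscent_zero _, (NeZero.ne n).symm⟩, ?_⟩
      have h1 : (Phi π).leftFace x = (Phi π).leftFace (Phi π).src :=
        hface _ _ (by rw [hx, en, han])
      refine Eq.trans ?_ h1.symm
      rw [Phi_outer hπ]
      exact hface _ _ (by rw [revFlip_revFlip, hd, e0])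
    · exact ⟨⟨a, ha, han⟩, hface _ _ (by rw [revFlip_revFlip, hd, hx])⟩

theorem card_ascents : Nat.card {a // IsAscent π a} +
    Nat.card {a // IsAscent (rev π) a ∧ a ≠ n} = n + 2 := by
  classical
  -- The ascents of `rev π` other than `n` are `0` and the reflections `n - a` of the descents `a`
  -- of `π`.
  set D := (Finset.range (n + 1)).filter fun a => ¬ IsAscent π a with hD
  have hDn : ∀ a ∈ D, 0 < a ∧ a < n ∧ ¬ IsAscent π a := by
    intro a ha
    simp only [hD, Finset.mem_filter, Finset.mem_range] at ha
    refine ⟨Nat.pos_of_ne_zero ?_, lt_of_le_of_ne (by omega) ?_, ha.2⟩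
    · rintro rfl
      exact ha.2 (isAscent_zero π)
    · rintro rfl
      exact ha.2 (isAscent_last π)
  have h1 : Nat.card {a // IsAscent π a} =
      ((Finset.range (n + 1)).filter fun a => IsAscent π a).card := by
    apply Nat.subtype_card
    intro a
    simp only [Finset.mem_filter, Finset.mem_range]
    exact ⟨fun h => h.2, fun h => ⟨by have := h.1; omega, h⟩⟩
  have h2 : Nat.card {a // IsAscent (rev π) a ∧ a ≠ n} =
      (insert 0 (D.image fun a => n - a)).card := by
    apply Nat.subtype_card
    intro a
    simp only [Finset.mem_insert, Finset.mem_image]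
    constructor
    · rintro (rfl | ⟨c, hc, rfl⟩)
      · exact ⟨isAscent_zero _, (NeZero.ne n).symm⟩
      · obtain ⟨hc1, hc2, hc3⟩ := hDn c hc
        refine ⟨(isAscent_rev_iff (by omega) (by omega)).2 ?_, by omega⟩
        rwa [Nat.sub_sub_self hc2.le]
    · rintro ⟨ha, han⟩
      have han' := ha.1
      rcases Nat.eq_zero_or_pos a with h0 | h0
      · exact Or.inl h0
      · refine Or.inr ⟨n - a, ?_, by omega⟩
        simp only [hD, Finset.mem_filter, Finset.mem_range]
        exact ⟨by omega, (isAscent_rev_iff h0 (by omega)).1 ha⟩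
  have h3 : (insert 0 (D.image fun a => n - a)).card = D.card + 1 := by
    rw [Finset.card_insert_of_notMem, Finset.card_image_of_injOn]
    · intro a ha c hc hac
      have := hDn a ha
      have := hDn c hc
      simp only at hac
      omega
    · simp only [Finset.mem_image, not_exists, not_and]
      intro a ha
      have := hDn a ha
      omega
  have h4 : ((Finset.range (n + 1)).filter fun a => IsAscent π a).card + D.card = n + 1 := by
    rw [hD]
    convert Finset.card_filter_add_card_filter_not (s := Finset.range (n + 1))
      (fun a => IsAscent π a)
    simp
  rw [h1, h2, h3]
  omega

theorem IsBaxter.isPlaneBipolar (h : IsBaxter π) : (Phi π).IsPlaneBipolar := by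
  have hπ := isBaxter_iff.1 h
  exact
    { finite := inferInstance
      connected := Phi_connected hπ
      euler := by rw [card_vertex hπ, h.card_face, card_ascents, Nat.card_fin]
      acyclic := Phi_acyclic hπ
      unique_source := Phi_isSource_iff hπ
      unique_sink := Phi_isSink_iff hπ
      outer := Phi_outer hπ }

end

end BaxterBipolar

theorem mainTheorem3 {n : ℕ} [NeZero n] (π : Equiv.Perm (Fin n)) (hπ : BaxterBipolar.IsBaxter π) :
    (BaxterBipolar.IsBaxter π⁻¹ ∧ BaxterBipolar.IsBaxter (BaxterBipolar.rev π) ∧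
      BaxterBipolar.IsBaxter (BaxterBipolar.rho π)) ∧
    (BaxterBipolar.BlackDegreesOne π ∧ (BaxterBipolar.Phi π).IsPlaneBipolar) ∧
    BaxterBipolar.BipolarMap.IsIso π
      (BaxterBipolar.Phi π).mir (BaxterBipolar.Phi π⁻¹) ∧
    BaxterBipolar.BipolarMap.IsIso Fin.revPerm
      (BaxterBipolar.Phi π).dual.mir (BaxterBipolar.Phi (BaxterBipolar.rev π)) ∧
    BaxterBipolar.BipolarMap.IsIso π
      (BaxterBipolar.Phi π).dual (BaxterBipolar.Phi (BaxterBipolar.rho π)) :=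
  ⟨⟨hπ.inv, hπ.isBaxter_rev, BaxterBipolar.rho_eq π ▸ hπ.isBaxter_rev.inv⟩,
    ⟨hπ.blackDegreesOne, hπ.isPlaneBipolar⟩, hπ.isIso_inv, hπ.isIso_rev, hπ.isIso_rho⟩
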